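/- Let $\xi_0$ be a real random variable that is mean-zero, sub-Gaussian (that is, $\mathbb P[|\xi_0|\ge t]\le 2e^{-\kappa t^2}$ for all $t\ge 0$ and some $\kappa>0$) and satisfies $\mathbb P[\xi_0=0]=0$. For $n\ge 1$ let $f_n(z)=\sum_{k=0}^n \xi_k z^k$, where $\xi_0,\dots,\xi_n$ are i.i.d. For $|z|\le 1$ put $d_n(z)=\min\{n,(1-|z|)^{-1}\}$, with $(1-|z|)^{-1}=\infty$ if $|z|=1$. For $A\ge 1$, a point $z=re^{i\theta}$ with $0<r\le 1$ and $0<\theta<\pi$ is called $A$-smooth if $\|p\theta/\pi\|_{\mathbb R/\mathbb Z}\ge A/d_n(z)$ for every integer $p\in[1,A+1]$, where $\|x\|_{\mathbb R/\mathbb Z}$ is the distance from $x$ to the nearest integer. There is a universal constant $r_0\in(\tfrac12,1)$ such that for every $\tau\in(0,10^{-4}]$ there are constants $c,C>0$, depending only on $\tau$ and on the distribution of $\xi_0$, for which the following holds. Let $n\ge1$, let $z=re^{i\theta}$ with $r\in[r_0,1]$, let $d=d_n(z)$, and suppose that $z$ is $d^{7\tau}$-smooth. Then for all $t\ge0$ and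 all $a,b\ge d^{-3/2+11\tau}$, $$\sup_{\alpha,\beta\in\mathbb C}\mathbb P\Big[|f_n(z)-\alpha|\le a\,d^{1/2},\ |f_n'(z)-\beta|\le b\,d^{3/2},\ |f_n''(z)|\ge t\,d^{5/2}\Big]\le C e^{-ct^2}(ab)^2 .$$ -/

import Mathlib

open Polynomial MeasureTheory ProbabilityTheory

noncomputable section

/-- A probability law on `ℝ` is sub-Gaussian if `ν {x : |x| ≥ t} ≤ 2 exp (-κ t²)` for all `t ≥ 0`,
for some `κ > 0`. -/
def IsSubGaussianLaw (ν : Measure ℝ) : Prop :=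
  ∃ κ : ℝ, 0 < κ ∧ ∀ t : ℝ, 0 ≤ t → ν.real {x : ℝ | t ≤ |x|} ≤ 2 * Real.exp (-κ * t ^ 2)

/-- The Kac polynomial `∑_{k=0}^n x_k z^k` with real coefficients `x_0, …, x_n`, viewed as a
complex polynomial. -/
def kacPoly {n : ℕ} (x : Fin (n + 1) → ℝ) : ℂ[X] :=
  ∑ k : Fin (n + 1), C (x k : ℂ) * X ^ (k : ℕ)

/-- The effective degree `d_n(z) = min {n, (1 - |z|)⁻¹}` for `|z| ≤ 1`, where `(1 - |z|)⁻¹ = ∞`,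
and so `d_n(z) = n`, if `|z| = 1`. -/
def effDegree (n : ℕ) (z : ℂ) : ℝ :=
  if ‖z‖ < 1 then min (n : ℝ) (1 - ‖z‖)⁻¹ else n

/-- `A`-smoothness of a point `z = r e^{iθ}` of the closed unit disk in the open upper half-plane:
`‖p θ / π‖_{ℝ/ℤ} ≥ A / d_n(z)` for all integers `1 ≤ p ≤ A + 1`. Here `θ = arg z ∈ (0, π)`, and the
norm of `UnitAddCircle = ℝ/ℤ` is the distance to the nearest integer. -/
def IsSmoothPoint (n : ℕ) (A : ℝ) (z : ℂ) : Prop :=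
  ‖z‖ ≤ 1 ∧ 0 < z.im ∧
    ∀ p : ℤ, 1 ≤ p → (p : ℝ) ≤ A + 1 →
      A / effDegree n z ≤ ‖((p * z.arg / Real.pi : ℝ) : UnitAddCircle)‖

end

/-! The pair (f, f') at z takes values in ℂ², a space of real dimension four, with standard
deviations of order d^{1/2} and d^{3/2}. Gaussian smoothing bounds a small-ball probability by an
integral of the characteristic function, which at a frequency η is a product of values of `charFun
ν` at the reals `linExp z u v k`, with u = conj η₁ and v = conj η₂ / z. Put R = ‖u‖ + d‖v‖. The
product over a block of about d consecutive indices is at most exp(-c d R²) while R is below a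
constant (`sum_linExp_sq_ge`), and at most exp(-c d^τ) from there up to R = d²
(`sum_dist_int_sq_ge`); beyond that the Gaussian weight takes over (`weight_mul_le`). The integral
is then O(d⁻⁴), which cancels the factor d · d³ coming from the radii.

The middle range is the arithmetic part. By Dirichlet and smoothness, some p ≤ A = d^{7τ} makes ±z^p
close to 1, while a further power z^{pl}, with pl ≤ d/50, stays away from the real axis. Signed
differences with step p preserve the form (u + kv)z^k and shrink R by about 1/A, so boundedly many
of them bring it below 1/4. A sequence near integers then has small iterated differences; undoing
these one at a time shows that the original values are small, because a nonzero constant ±N cannot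
be imitated by `linExp` along step pl (`linExp_small_of_near_int`). If the distances to the integers
had a small sum of squares, a union bound would give two well-separated progressions without bad
indices, and so force R to be small.

The second derivative is decoupled by splitting its sum at an index m of order d/2: one of the two
parts carries half of the size. That part has a sub-Gaussian tail, and a block of m coefficients
independent of it still supplies the small-ball factor, so the two bounds multiply
(`eventually_small_ball`, `exists_joint_bound`). -/

/-! ### Sequences `k ↦ Re ((u + k v) z ^ k)` -/

/-- The real sequence `k ↦ Re ((u + k v) z ^ k)`. -/
noncomputable def linExp (z u v : ℂ) (k : ℕ) : ℝ := ((u + k * v) * z ^ k).re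

lemma norm_le_of_re_of_re_mul {Y ζ : ℂ} {c M : ℝ} (hc : 0 < c) (hζ : ‖ζ‖ ≤ 1) (hc' : c ≤ |ζ.im|)
    (h0 : |Y.re| ≤ M) (h1 : |(Y * ζ).re| ≤ M) : ‖Y‖ ≤ 3 * M / c := by
  have hM : 0 ≤ M := (abs_nonneg _).trans h0
  have hc1 : c ≤ 1 := hc'.trans ((Complex.abs_im_le_norm ζ).trans hζ)
  have hre : |ζ.re| ≤ 1 := (Complex.abs_re_le_norm ζ).trans hζ
  have him : |Y.im| * |ζ.im| ≤ 2 * M := by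
    have e : Y.im * ζ.im = Y.re * ζ.re - (Y * ζ).re := by simp [Complex.mul_re]
    rw [← abs_mul, e]
    calc _ ≤ |Y.re * ζ.re| + |(Y * ζ).re| := abs_sub _ _
      _ ≤ M * 1 + M := by
        rw [abs_mul]; gcongr
      _ = 2 * M := by ring
  have him' : |Y.im| ≤ 2 * M / c := by
    rw [le_div_iff₀ hc]
    exact (mul_le_mul_of_nonneg_left hc' (abs_nonneg _)).trans him
  calc ‖Y‖ ≤ |Y.re| + |Y.im| := Complex.norm_le_abs_re_add_abs_im Y
    _ ≤ M / c + 2 * M / c := by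
      refine add_le_add (h0.trans ?_) him'
      rw [le_div_iff₀ hc]; nlinarith
    _ = 3 * M / c := by ring

/-- The recurrence has characteristic roots ζ and its conjugate. It annihilates the real part of a
pure exponential, so only the contribution of the linear factor survives, and a second application
annihilates that too. -/
lemma two_step_identity (ζ a b : ℂ) (i : ℕ) :
    linExp ζ a b (i + 2) - 2 * ζ.re * linExp ζ a b (i + 1) + ‖ζ‖ ^ 2 * linExp ζ a b i =
      (b * ζ * (ζ - (starRingEnd ℂ) ζ) * ζ ^ i).re := by
  have h1 : ((2 * ζ.re : ℝ) : ℂ) = ζ + (starRingEnd ℂ) ζ := by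
    rw [Complex.add_conj]
  have h2 : ((‖ζ‖ ^ 2 : ℝ) : ℂ) = ζ * (starRingEnd ℂ) ζ := by
    rw [Complex.mul_conj, Complex.normSq_eq_norm_sq]
  unfold linExp
  rw [← Complex.re_ofReal_mul (2 * ζ.re), ← Complex.re_ofReal_mul (‖ζ‖ ^ 2), ← Complex.sub_re,
    ← Complex.add_re, h1, h2]
  congr 1
  push_cast
  ring

lemma abs_two_step_le {t n x0 x1 x2 δ : ℝ} (ht : |t| ≤ 1) (hn : 0 ≤ n) (hn' : n ≤ 1)
    (h0 : |x0| ≤ δ) (h1 : |x1| ≤ δ) (h2 : |x2| ≤ δ) :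
    |x2 - 2 * t * x1 + n ^ 2 * x0| ≤ 4 * δ := by
  have hδ : 0 ≤ δ := (abs_nonneg _).trans h0
  have a1 : |2 * t * x1| ≤ 2 * δ := by
    rw [abs_mul, abs_mul, abs_two]; nlinarith [abs_nonneg t, abs_nonneg x1]
  have a2 : |n ^ 2 * x0| ≤ δ := by
    rw [abs_mul, abs_of_nonneg (by positivity)]
    have : n ^ 2 ≤ 1 := pow_le_one₀ hn hn'
    nlinarith [abs_nonneg x0]
  have := abs_add_le (x2 - 2 * t * x1) (n ^ 2 * x0)
  have := abs_sub x2 (2 * t * x1)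
  linarith

/-- Four consecutive values control the leading coefficient. -/
lemma norm_le_of_linExp_small {ζ a b : ℂ} {c δ : ℝ} (hc : 0 < c) (hζ : ‖ζ‖ ≤ 1)
    (hc' : c ≤ |ζ.im|) (h : ∀ i ≤ 3, |linExp ζ a b i| ≤ δ) : ‖a‖ ≤ 21 * δ / c ^ 3 := by
  have hδ : 0 ≤ δ := (abs_nonneg _).trans (h 0 (by norm_num))
  have hre : |ζ.re| ≤ 1 := (Complex.abs_re_le_norm ζ).trans hζ
  have hc1 : c ≤ 1 := hc'.trans ((Complex.abs_im_le_norm ζ).trans hζ)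
  have hc2 : c ^ 2 ≤ 1 := pow_le_one₀ hc.le hc1
  -- The recurrence isolates `b` first: its values at 0 and 1, which involve the four given values,
  -- control `Y`. Then `a` is recovered by subtraction.
  set Y : ℂ := b * ζ * (ζ - (starRingEnd ℂ) ζ) with hY
  have y0 : |Y.re| ≤ 4 * δ := by
    have := two_step_identity ζ a b 0
    rw [pow_zero, mul_one] at this
    rw [hY, ← this]
    exact abs_two_step_le hre (norm_nonneg _) hζ (h 0 (by norm_num)) (h 1 (by norm_num))
      (h 2 (by norm_num))
  have y1 : |(Y * ζ).re| ≤ 4 * δ := by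
    have := two_step_identity ζ a b 1
    rw [pow_one] at this
    rw [hY, ← this]
    exact abs_two_step_le hre (norm_nonneg _) hζ (h 1 (by norm_num)) (h 2 (by norm_num))
      (h 3 (by norm_num))
  have hYn := norm_le_of_re_of_re_mul hc hζ hc' y0 y1
  have hb : ‖b * ζ‖ ≤ 6 * δ / c ^ 2 := by
    have e : ‖Y‖ = ‖b * ζ‖ * (2 * |ζ.im|) := by
      rw [hY, norm_mul, Complex.sub_conj]; simp
    rw [e, le_div_iff₀ hc] at hYn
    rw [le_div_iff₀ (by positivity)]
    nlinarith [mul_le_mul_of_nonneg_left hc' (mul_nonneg (norm_nonneg (b * ζ)) hc.le)]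
  have a0 : |a.re| ≤ 7 * δ / c ^ 2 := by
    have := h 0 (by norm_num)
    simp only [linExp, Nat.cast_zero, zero_mul, add_zero, pow_zero, mul_one] at this
    refine this.trans ?_
    rw [le_div_iff₀ (by positivity)]
    nlinarith
  have a1 : |(a * ζ).re| ≤ 7 * δ / c ^ 2 := by
    have h1 := h 1 (by norm_num)
    have e : (a * ζ).re = linExp ζ a b 1 - (b * ζ).re := by
      simp only [linExp, Nat.cast_one, one_mul, pow_one]
      rw [← Complex.sub_re]; congr 1; ring
    rw [e]
    have h3 : δ ≤ δ / c ^ 2 := by rw [le_div_iff₀ (by positivity)]; nlinarith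
    calc _ ≤ |linExp ζ a b 1| + |(b * ζ).re| := abs_sub _ _
      _ ≤ δ / c ^ 2 + 6 * δ / c ^ 2 :=
        add_le_add (h1.trans h3) ((Complex.abs_re_le_norm _).trans hb)
      _ = _ := by ring
  refine (norm_le_of_re_of_re_mul hc hζ hc' a0 a1).trans (le_of_eq ?_)
  field_simp
  ring

/-- A sequence of this shape that is close to `± N` with a fixed sign pattern has `N = 0`. -/
lemma int_eq_zero_of_linExp_near {ζ a b : ℂ} {c δ σ : ℝ} {N : ℤ} (hc : 0 < c) (hζ : ‖ζ‖ ≤ 1)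
    (hc' : c ≤ |ζ.im|) (hσ : |σ| = 1) (hδ : 16 * δ < c ^ 4)
    (h : ∀ i ≤ 4, |linExp ζ a b i - σ ^ i * N| ≤ δ) : N = 0 := by
  have hre : |ζ.re| ≤ 1 := (Complex.abs_re_le_norm ζ).trans hζ
  have hσ2 : σ ^ 2 = 1 := by rw [← sq_abs, hσ, one_pow]
  set e : ℕ → ℝ := fun i => linExp ζ a b i - σ ^ i * N with he
  set E : ℕ → ℝ := fun i => e (i + 2) - 2 * ζ.re * e (i + 1) + ‖ζ‖ ^ 2 * e i with hE
  have hEb : ∀ i ≤ 2, |E i| ≤ 4 * δ := fun i hi =>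
    abs_two_step_le hre (norm_nonneg _) hζ (h i (by omega)) (h (i + 1) (by omega))
      (h (i + 2) (by omega))
  have hF : |E 2 - 2 * ζ.re * E 1 + ‖ζ‖ ^ 2 * E 0| ≤ 4 * (4 * δ) :=
    abs_two_step_le hre (norm_nonneg _) hζ (hEb 0 (by norm_num)) (hEb 1 (by norm_num))
      (hEb 2 (by norm_num))
  -- The eigenvalue of the recurrence on `σ ^ i`. It equals |σ - ζ|², hence is at least `ζ.im ^ 2`;
  -- two applications kill `linExp` and leave `q ^ 2 * N`.
  set q : ℝ := σ ^ 2 - 2 * ζ.re * σ + ‖ζ‖ ^ 2 with hq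
  set Y : ℂ := b * ζ * (ζ - (starRingEnd ℂ) ζ) with hY
  have hEi : ∀ i, E i = linExp ζ Y 0 i - q * σ ^ i * N := by
    intro i
    have := two_step_identity ζ a b i
    simp only [hE, he]
    have e1 : linExp ζ Y 0 i = (Y * ζ ^ i).re := by simp [linExp]
    rw [e1, hY, ← this, hq]
    ring
  have hFe : E 2 - 2 * ζ.re * E 1 + ‖ζ‖ ^ 2 * E 0 = - (q ^ 2 * N) := by
    have := two_step_identity ζ Y 0 0
    simp only [zero_mul, Complex.zero_re, zero_add] at this
    rw [hEi 0, hEi 1, hEi 2]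
    linear_combination this - q * N * hq
  have hqc : c ^ 2 ≤ q := by
    have hn : ‖ζ‖ ^ 2 = ζ.re ^ 2 + ζ.im ^ 2 := by
      rw [← Complex.normSq_eq_norm_sq, Complex.normSq_apply]; ring
    have : c ^ 2 ≤ ζ.im ^ 2 := by rw [← sq_abs ζ.im]; gcongr
    rw [hq, hn]; nlinarith [sq_nonneg (σ - ζ.re)]
  rw [hFe, abs_neg, abs_mul, abs_of_nonneg (sq_nonneg q)] at hF
  by_contra hN
  have hN1 : (1 : ℝ) ≤ |(N : ℝ)| := by
    have := Int.one_le_abs hN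
    exact_mod_cast this
  have : c ^ 4 ≤ q ^ 2 := by
    calc c ^ 4 = (c ^ 2) ^ 2 := by ring
      _ ≤ q ^ 2 := by gcongr
  nlinarith [sq_nonneg q]

/-- Passing to an arithmetic progression stays inside the family, with base `z ^ q`. This lets one
use a power of `z` that is far from the real axis. -/
lemma linExp_add_mul (z u v : ℂ) (k q i : ℕ) :
    linExp z u v (k + q * i) = linExp (z ^ q) ((u + k * v) * z ^ k) (q * v * z ^ k) i := by
  unfold linExp
  congr 1
  push_cast
  rw [pow_add, pow_mul]
  ring

/-- When `σ * z ^ p` is near 1 and `p` is small against d, the new coefficients are small multiples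
of the old ones in the norm ‖u‖ + d‖v‖. -/
lemma linExp_diff (z u v : ℂ) (σ : ℝ) (p k : ℕ) :
    σ * linExp z u v (k + p) - linExp z u v k =
      linExp z ((σ * z ^ p - 1) * u + σ * p * z ^ p * v) ((σ * z ^ p - 1) * v) k := by
  unfold linExp
  rw [← Complex.re_ofReal_mul, ← Complex.sub_re]
  congr 1
  push_cast
  rw [pow_add]
  ring

lemma abs_linExp_le {z u v : ℂ} (hz : ‖z‖ ≤ 1) {k : ℕ} {d : ℝ} (hk : (k : ℝ) ≤ d) :
    |linExp z u v k| ≤ ‖u‖ + d * ‖v‖ := by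
  refine (Complex.abs_re_le_norm _).trans ?_
  rw [norm_mul, norm_pow]
  have h1 : ‖u + k * v‖ ≤ ‖u‖ + d * ‖v‖ := by
    refine (norm_add_le _ _).trans ?_
    rw [norm_mul, Complex.norm_natCast]
    gcongr
  exact (mul_le_of_le_one_right (norm_nonneg _) (pow_le_one₀ (norm_nonneg _) hz)).trans h1

lemma int_eq_zero_of_abs_lt_one {N : ℤ} (h : |(N : ℝ)| < 1) : N = 0 := by
  rw [← Int.abs_lt_one_iff]; exact_mod_cast h

/-- If the values along a progression are near integers and the signed increments are small, then
the values themselves are small. -/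
lemma linExp_small_of_diff_small {z u v : ℂ} {c δ σ : ℝ} {p l k : ℕ} (hc : 0 < c)
    (hz : ‖z‖ ≤ 1) (hc' : c ≤ |(z ^ (p * l)).im|) (hσ : |σ| = 1) (hδ : 16 * δ < c ^ 4)
    (hint : ∀ i ≤ 4 * l, ∃ N : ℤ, |linExp z u v (k + p * i) - N| ≤ δ)
    (hdiff : ∀ i < 4 * l,
      |σ * linExp z u v (k + p * (i + 1)) - linExp z u v (k + p * i)| + 2 * δ < 1)
    {i : ℕ} (hi : i ≤ 4 * l) : |linExp z u v (k + p * i)| ≤ δ := by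
  have hσ2 : σ ^ 2 = 1 := by rw [← sq_abs, hσ, one_pow]
  obtain ⟨N, hN⟩ := hint 0 (by omega)
  -- Increments too small to jump to another integer lock the nearest integer to the pattern `σ ^ i
  -- * N`.
  have key : ∀ i ≤ 4 * l, |linExp z u v (k + p * i) - σ ^ i * N| ≤ δ := by
    intro i
    induction i with
    | zero => intro _; simpa using hN
    | succ i ih =>
      intro hi
      have ih := ih (by omega)
      obtain ⟨M, hM⟩ := hint (i + 1) hi
      have hd := hdiff i (by omega)
      set x := linExp z u v (k + p * i)
      set y := linExp z u v (k + p * (i + 1))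
      have hσcase : σ = 1 ∨ σ = -1 := by
        rcases abs_eq (by norm_num : (0:ℝ) ≤ 1) |>.1 hσ with h | h <;> simp [h]
      obtain ⟨K, hK⟩ : ∃ K : ℤ, (K : ℝ) = σ ^ (i + 1) * N := by
        rcases hσcase with h | h <;> rw [h]
        · exact ⟨N, by simp⟩
        · exact ⟨(-1) ^ (i + 1) * N, by push_cast; ring⟩
      have : M - K = 0 := by
        apply int_eq_zero_of_abs_lt_one
        push_cast
        rw [hK]
        have e : (M : ℝ) - σ ^ (i + 1) * N =
            (M - y) + σ * ((σ * y - x) + (x - σ ^ i * N)) := by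
          rw [pow_succ]; linear_combination (-y) * hσ2
        rw [e]
        have h1 := abs_add_le ((M : ℝ) - y) (σ * ((σ * y - x) + (x - σ ^ i * N)))
        rw [abs_mul, hσ, one_mul] at h1
        have h2 := abs_add_le (σ * y - x) (x - σ ^ i * N)
        have h3 : |(M : ℝ) - y| ≤ δ := by rw [abs_sub_comm]; exact hM
        linarith
      rw [← hK, ← sub_eq_zero.1 this]
      exact hM
  have hN0 : N = 0 := by
    -- Only every `l`-th point is used: the base `z ^ (p * l)` has imaginary part at least `c`,
    -- whereas `z ^ p` may be nearly real.
    refine int_eq_zero_of_linExp_near (ζ := z ^ (p * l)) (a := (u + k * v) * z ^ k)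
      (b := ((p * l : ℕ) : ℂ) * v * z ^ k) (σ := σ ^ l) hc ?_ hc' ?_ hδ ?_
    · rw [norm_pow]; exact pow_le_one₀ (norm_nonneg _) hz
    · rw [abs_pow, hσ, one_pow]
    · intro i hi
      rw [← linExp_add_mul, mul_assoc, ← pow_mul]
      exact key _ (by nlinarith)
  have := key i hi
  simpa [hN0] using this

/-- Iterating differences along the progression: a sequence of polynomially bounded amplitude that
is near the integers along a long progression is small there. -/
lemma linExp_small_of_near_int {z : ℂ} {c d ρ σ : ℝ} {p l k : ℕ} (hc : 0 < c) (hd : 0 < d)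
    (hz : ‖z‖ ≤ 1) (hc' : c ≤ |(z ^ (p * l)).im|) (hσ : |σ| = 1)
    (hρ : ‖(σ : ℂ) * z ^ p - 1‖ + p / d ≤ ρ) (hρ0 : 0 ≤ ρ) (hkd : ((k + p * (4 * l) : ℕ) : ℝ) ≤ d)
    (j : ℕ) : ∀ (u v : ℂ) (δ : ℝ), ρ ^ j * (‖u‖ + d * ‖v‖) ≤ 1 / 4 → 32 * (2 ^ j * δ) ≤ c ^ 4 →
      (∀ i ≤ 4 * l + j, ∃ N : ℤ, |linExp z u v (k + p * i) - N| ≤ δ) →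
      ∀ i ≤ 4 * l, |linExp z u v (k + p * i)| ≤ δ := by
  have hc1 : c ≤ 1 := by
    refine hc'.trans ((Complex.abs_im_le_norm _).trans ?_)
    rw [norm_pow]; exact pow_le_one₀ (norm_nonneg _) hz
  have hc4 : c ^ 4 ≤ 1 := pow_le_one₀ hc.le hc1
  have hc40 : 0 < c ^ 4 := by positivity
  induction j with
  | zero =>
    intro u v δ hamp hδ hint i hi
    obtain ⟨N, hN⟩ := hint i (by omega)
    have hk : ((k + p * i : ℕ) : ℝ) ≤ d := by
      refine le_trans ?_ hkd
      exact_mod_cast Nat.add_le_add_left (Nat.mul_le_mul_left p hi) k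
    have hs := abs_linExp_le (u := u) (v := v) hz hk
    have : N = 0 := by
      apply int_eq_zero_of_abs_lt_one
      have h1 := abs_sub (linExp z u v (k + p * i)) (linExp z u v (k + p * i) - N)
      rw [sub_sub_cancel] at h1
      simp only [pow_zero, one_mul] at hamp hδ
      linarith
    simpa [this] using hN
  | succ j ih =>
    intro u v δ hamp hδ hint i hi
    have hδ0 : 0 ≤ δ := by
      obtain ⟨N, hN⟩ := hint 0 (by omega)
      exact (abs_nonneg _).trans hN
    have h2j : (1 : ℝ) ≤ 2 ^ j := one_le_pow₀ (by norm_num)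
    have hδ' : 32 * (2 * δ) ≤ c ^ 4 := by
      rw [pow_succ] at hδ
      nlinarith
    -- One signed difference multiplies the amplitude by at most `ρ`, doubles the distance to the
    -- integers and uses up one point of the progression.
    set u' : ℂ := (σ * z ^ p - 1) * u + σ * p * z ^ p * v with hu'
    set v' : ℂ := (σ * z ^ p - 1) * v with hv'
    have hstep : ∀ i, σ * linExp z u v (k + p * (i + 1)) - linExp z u v (k + p * i) =
        linExp z u' v' (k + p * i) := by
      intro i
      rw [← linExp_diff]; ring_nf
    have hdiff : ∀ i ≤ 4 * l, |linExp z u' v' (k + p * i)| ≤ 2 * δ := by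
      refine ih u' v' (2 * δ) ?_ ?_ ?_
      · have hzp : ‖z ^ p‖ ≤ 1 := by rw [norm_pow]; exact pow_le_one₀ (norm_nonneg _) hz
        have hu : ‖u'‖ ≤ ‖(σ : ℂ) * z ^ p - 1‖ * ‖u‖ + p * ‖v‖ := by
          refine (norm_add_le _ _).trans ?_
          rw [norm_mul]
          gcongr
          rw [norm_mul, norm_mul, norm_mul, Complex.norm_natCast, Complex.norm_real,
            Real.norm_eq_abs, hσ, one_mul]
          gcongr
          exact mul_le_of_le_one_right (by positivity) hzp
        have hv : ‖v'‖ = ‖(σ : ℂ) * z ^ p - 1‖ * ‖v‖ := norm_mul _ _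
        have hamp' : ‖u'‖ + d * ‖v'‖ ≤ ρ * (‖u‖ + d * ‖v‖) := by
          have hpd : (p : ℝ) * ‖v‖ = p / d * (d * ‖v‖) := by field_simp
          have h1 : p / d * (d * ‖v‖) ≤ p / d * (‖u‖ + d * ‖v‖) := by
            gcongr; linarith [norm_nonneg u]
          calc _ ≤ (‖(σ : ℂ) * z ^ p - 1‖ + p / d) * (‖u‖ + d * ‖v‖) := by
                rw [hv]; linarith
            _ ≤ _ := by gcongr
        calc ρ ^ j * (‖u'‖ + d * ‖v'‖) ≤ ρ ^ j * (ρ * (‖u‖ + d * ‖v‖)) := by gcongr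
          _ = ρ ^ (j + 1) * (‖u‖ + d * ‖v‖) := by ring
          _ ≤ _ := hamp
      · calc _ = 32 * (2 ^ (j + 1) * δ) := by ring
          _ ≤ _ := hδ
      · intro i hi
        obtain ⟨N, hN⟩ := hint i (by omega)
        obtain ⟨M, hM⟩ := hint (i + 1) (by omega)
        have hσcase : ∃ s : ℤ, (s : ℝ) = σ := by
          rcases abs_eq (by norm_num : (0:ℝ) ≤ 1) |>.1 hσ with h | h
          · exact ⟨1, by simp [h]⟩
          · exact ⟨-1, by simp [h]⟩
        obtain ⟨s, hs⟩ := hσcase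
        refine ⟨s * M - N, ?_⟩
        rw [← hstep]
        push_cast
        rw [hs]
        have e : σ * linExp z u v (k + p * (i + 1)) - linExp z u v (k + p * i) - (σ * M - N) =
          σ * (linExp z u v (k + p * (i + 1)) - M) - (linExp z u v (k + p * i) - N) := by ring
        rw [e]
        refine (abs_sub _ _).trans ?_
        rw [abs_mul, hσ]
        linarith
    refine linExp_small_of_diff_small hc hz hc' hσ (by linarith) (fun i hi => hint i (by omega))
      (fun i hi => ?_) hi
    rw [hstep]
    have := hdiff i hi.le
    linarith

/-! ### Geometry of smooth points -/

lemma one_half_le_pow {r d : ℝ} (hr0 : 0 ≤ r) (hd : 1 ≤ d) (hr : 1 - r ≤ 1 / d) {q : ℕ}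
    (hq : (q : ℝ) ≤ d / 2) : 1 / 2 ≤ r ^ q := by
  have hd0 : 0 < d := by linarith
  have h1 : 1 + (q : ℝ) * (r - 1) ≤ r ^ q := by
    have := one_add_mul_le_pow (a := r - 1) (by linarith) q
    simpa using this
  have h2 : (q : ℝ) * (1 - r) ≤ d / 2 * (1 / d) := by
    by_cases h : r ≤ 1
    · exact mul_le_mul hq hr (by linarith) (by positivity)
    · have : (q : ℝ) * (1 - r) ≤ 0 := mul_nonpos_of_nonneg_of_nonpos (by positivity) (by linarith)
      exact this.trans (by positivity)
  have h3 : d / 2 * (1 / d) = 1 / 2 := by field_simp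
  linarith

lemma one_sub_pow_le {r : ℝ} (hr0 : 0 ≤ r) (p : ℕ) : 1 - r ^ p ≤ p * (1 - r) := by
  have := one_add_mul_le_pow (a := r - 1) (by linarith) p
  simp only [add_sub_cancel] at this
  linarith

/-- Dirichlet's theorem yields p ≤ A with pθ within π/A of a multiple of π. Smoothness keeps the
remainder φ above πA/d, so about 1/|φ| further steps, still O(d/A), rotate `z ^ p` by a definite
angle. The modulus stays at least 1/2 over so short a range. -/
lemma exists_progression_of_smooth {z : ℂ} {A d : ℝ} (hz : ‖z‖ ≤ 1) (hA : 100 ≤ A)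
    (hAd : 1000 * A ^ 2 ≤ d) (hr : 1 - ‖z‖ ≤ 1 / d)
    (hs : ∀ p : ℤ, 1 ≤ p → (p : ℝ) ≤ A + 1 →
      A / d ≤ ‖((p * z.arg / Real.pi : ℝ) : UnitAddCircle)‖) :
    ∃ (p l : ℕ) (σ : ℝ), |σ| = 1 ∧ (p : ℝ) ≤ A ∧ (l : ℝ) ≤ d / A ∧ ((p * l : ℕ) : ℝ) ≤ d / 50 ∧
      ‖(σ : ℂ) * z ^ p - 1‖ + p / d ≤ 8 / A ∧ 1 / 100 ≤ |(z ^ (p * l)).im| := by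
  have hA0 : 0 < A := by linarith
  have hd : 1 ≤ d := by nlinarith
  have hd0 : 0 < d := by linarith
  have hAd' : 1000 * A ≤ d := by nlinarith
  have hpi := Real.pi_pos
  set α : ℝ := z.arg / Real.pi with hα
  obtain ⟨p, hp0, hpA, hp⟩ := Real.exists_nat_abs_mul_sub_round_le α
    (n := ⌊A⌋₊) (Nat.floor_pos.2 (by linarith))
  have hpA' : (p : ℝ) ≤ A := (Nat.cast_le.2 hpA).trans (Nat.floor_le hA0.le)
  set N : ℤ := round (p * α) with hN
  set φ : ℝ := Real.pi * (p * α - N) with hφ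
  have hφu : |φ| ≤ Real.pi / A := by
    rw [hφ, abs_mul, abs_of_pos hpi, div_eq_mul_inv]
    gcongr
    refine hp.trans ?_
    rw [← one_div]
    gcongr
    exact (Nat.lt_floor_add_one A).le
  have hφl : Real.pi * A / d ≤ |φ| := by
    have h1 := hs p (by exact_mod_cast hp0) (by push_cast; linarith)
    rw [UnitAddCircle.norm_eq] at h1
    have e : ((p : ℤ) : ℝ) * z.arg / Real.pi = p * α := by rw [hα]; push_cast; ring
    rw [e] at h1
    rw [hφ, abs_mul, abs_of_pos hpi, mul_div_assoc]
    gcongr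
  have hφ0 : 0 < |φ| := lt_of_lt_of_le (by positivity) hφl
  set σ : ℝ := (-1) ^ N.natAbs with hσ
  have hσ1 : |σ| = 1 := by rw [hσ, abs_pow]; simp
  have hσ2 : (σ : ℂ) * σ = 1 := by
    have : σ * σ = 1 := by rw [← abs_mul_abs_self, hσ1, one_mul]
    exact_mod_cast this
  have hexpN : Complex.exp (((N * Real.pi : ℝ) : ℂ) * Complex.I) = σ := by
    rw [Complex.exp_mul_I, ← Complex.ofReal_cos, ← Complex.ofReal_sin, Real.sin_int_mul_pi,
      Real.cos_int_mul_pi]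
    rw [hσ]
    rcases Int.even_or_odd N with h | h
    · rw [h.neg_one_zpow, (Int.natAbs_even.2 h).neg_one_pow]; simp
    · rw [h.neg_one_zpow, (Int.natAbs_odd.2 h).neg_one_pow]; simp
  have hzp : z ^ p = σ * ((‖z‖ ^ p : ℝ) : ℂ) * Complex.exp ((φ : ℂ) * Complex.I) := by
    conv_lhs => rw [← Complex.norm_mul_exp_arg_mul_I z]
    rw [mul_pow, ← Complex.exp_nat_mul]
    have e : (p : ℂ) * (z.arg * Complex.I) =
        ((N * Real.pi : ℝ) : ℂ) * Complex.I + (φ : ℂ) * Complex.I := by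
      have : (p : ℝ) * z.arg = N * Real.pi + φ := by rw [hφ, hα]; field_simp; ring
      rw [← add_mul, ← Complex.ofReal_add, ← this]; push_cast; ring
    rw [e, Complex.exp_add, hexpN]
    push_cast; ring
  -- This puts l|φ| between 1/20 and 1/10, where the sine is bounded below.
  set l : ℕ := ⌈1 / (20 * |φ|)⌉₊ with hl
  have hl1 : 1 / (20 * |φ|) ≤ l := Nat.le_ceil _
  have hl2 : (l : ℝ) < 1 / (20 * |φ|) + 1 := Nat.ceil_lt_add_one (by positivity)
  have hlφ1 : 1 / 20 ≤ l * |φ| := by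
    rw [div_le_iff₀ (by positivity)] at hl1; linarith
  have hlφ2 : l * |φ| ≤ 1 / 20 + |φ| := by
    have : 1 / (20 * |φ|) * |φ| = 1 / 20 := by field_simp
    nlinarith
  have hpi4 := Real.pi_le_four
  have hpi3 := Real.pi_gt_three
  have hφs : |φ| ≤ 1 / 20 := hφu.trans (by rw [div_le_div_iff₀ hA0 (by norm_num)]; linarith)
  have hl3 : (l : ℝ) ≤ d / (60 * A) + 1 := by
    have : 1 / (20 * |φ|) ≤ d / (60 * A) := by
      rw [div_le_div_iff₀ (by positivity) (by positivity)]
      rw [div_le_iff₀ hd0] at hφl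
      nlinarith
    linarith
  have hpl : ((p * l : ℕ) : ℝ) ≤ d / 50 := by
    push_cast
    calc (p : ℝ) * l ≤ A * (d / (60 * A) + 1) := by gcongr
      _ = d / 60 + A := by field_simp
      _ ≤ d / 50 := by linarith
  refine ⟨p, l, σ, hσ1, hpA', ?_, hpl, ?_, ?_⟩
  · refine hl3.trans ?_
    have : d / (60 * A) = d / A / 60 := by field_simp
    have h2 : 1000 ≤ d / A := by rw [le_div_iff₀ hA0]; exact hAd'
    linarith
  · have e : (σ : ℂ) * z ^ p - 1 = ((‖z‖ ^ p - 1 : ℝ) : ℂ) * Complex.exp ((φ : ℂ) * Complex.I) +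
        (Complex.exp ((φ : ℂ) * Complex.I) - 1) := by
      rw [hzp]; push_cast; linear_combination ((‖z‖:ℂ) ^ p * Complex.exp (φ * Complex.I)) * hσ2
    have h1 : ‖(σ : ℂ) * z ^ p - 1‖ ≤ p / d + |φ| := by
      rw [e]
      refine (norm_add_le _ _).trans (add_le_add ?_ ?_)
      · rw [norm_mul, Complex.norm_exp_ofReal_mul_I, mul_one, Complex.norm_real, Real.norm_eq_abs,
          abs_sub_comm, abs_of_nonneg (by linarith [pow_le_one₀ (n := p) (norm_nonneg z) hz])]
        refine (one_sub_pow_le (norm_nonneg z) p).trans ?_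
        rw [div_eq_mul_one_div]
        gcongr
      · rw [mul_comm]
        exact (Real.norm_exp_I_mul_ofReal_sub_one_le).trans (by rw [Real.norm_eq_abs])
    have h2 : (p : ℝ) / d ≤ 1 / A := by
      rw [div_le_div_iff₀ hd0 hA0]; nlinarith
    have h3 : Real.pi / A ≤ 4 / A := by gcongr
    have : 8 / A = 1 / A + 4 / A + 1 / A + 2 / A := by ring
    have : 0 < 2 / A := by positivity
    linarith
  · have hzq : z ^ (p * l) = ((σ ^ l * ‖z‖ ^ (p * l) : ℝ) : ℂ) *
        Complex.exp (((l * φ : ℝ) : ℂ) * Complex.I) := by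
      rw [pow_mul, hzp, mul_pow, mul_pow, ← Complex.exp_nat_mul]
      push_cast
      rw [← pow_mul]
      ring_nf
    have him : (z ^ (p * l)).im = σ ^ l * ‖z‖ ^ (p * l) * Real.sin (l * φ) := by
      rw [hzq, Complex.im_ofReal_mul, Complex.exp_ofReal_mul_I_im]
    rw [him, abs_mul, abs_mul, abs_pow σ, hσ1, one_pow, one_mul, abs_of_nonneg (by positivity)]
    have hsin : 1 / 35 ≤ |Real.sin (l * φ)| := by
      have e : |Real.sin (l * φ)| = |Real.sin (l * |φ|)| := by
        rcases abs_cases φ with h | h <;> rw [h.1]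
        rw [mul_neg, Real.sin_neg, abs_neg]
      rw [e]
      have := Real.mul_le_sin (x := l * |φ|) (by positivity) (by linarith)
      refine le_trans ?_ (this.trans (le_abs_self _))
      have h2 : 4 / 7 ≤ 2 / Real.pi := by
        rw [div_le_div_iff₀ (by norm_num) hpi]; linarith [Real.pi_lt_d2]
      nlinarith
    have hrq := one_half_le_pow (norm_nonneg z) hd hr (q := p * l) (by linarith)
    nlinarith

/-! ### Counting -/

/-- Union bound: each pair of a shift in `S` and a bad point in `B` rules out at most one start. -/
lemma exists_translate_disjoint (B S : Finset ℕ) (s w : ℕ) (h : S.card * B.card < w) :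
    ∃ x, s ≤ x ∧ x < s + w ∧ ∀ i ∈ S, x + i ∉ B := by
  by_contra! hcon
  have hsub : Finset.Ico s (s + w) ⊆ S.biUnion fun i => B.image fun b => b - i := by
    intro x hx
    rw [Finset.mem_Ico] at hx
    obtain ⟨i, hi, hb⟩ := hcon x hx.1 hx.2
    rw [Finset.mem_biUnion]
    exact ⟨i, hi, Finset.mem_image.2 ⟨x + i, hb, by omega⟩⟩
  have h1 := Finset.card_le_card hsub
  rw [Nat.card_Ico] at h1
  have h2 := Finset.card_biUnion_le_card_mul S (fun i => B.image fun b => b - i) B.card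
    fun i _ => Finset.card_image_le
  omega

/-- Two well-separated points at which the coefficient `u + k v` is small control the amplitude. -/
lemma amp_le_of_two_points {z u v : ℂ} {d C : ℝ} {x y : ℕ} (hd : 1 ≤ d) (hr : 1 - ‖z‖ ≤ 1 / d)
    (hx : (x : ℝ) ≤ d / 2) (hy : (y : ℝ) ≤ d / 2) (hxy : d / 40 ≤ (y : ℝ) - x)
    (h1 : ‖(u + x * v) * z ^ x‖ ≤ C) (h2 : ‖(u + y * v) * z ^ y‖ ≤ C) :
    ‖u‖ + d * ‖v‖ ≤ 400 * C := by
  have hC : 0 ≤ C := (norm_nonneg _).trans h1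
  have aux : ∀ k : ℕ, (k : ℝ) ≤ d / 2 → ‖(u + k * v) * z ^ k‖ ≤ C → ‖u + k * v‖ ≤ 2 * C := by
    intro k hk h
    rw [norm_mul, norm_pow] at h
    have := one_half_le_pow (norm_nonneg z) hd hr hk
    nlinarith [norm_nonneg (u + k * v)]
  have k1 := aux x hx h1
  have k2 := aux y hy h2
  have hv : ((y : ℝ) - x) * ‖v‖ ≤ 4 * C := by
    have e : (((y : ℝ) - x : ℝ) : ℂ) * v = (u + y * v) - (u + x * v) := by push_cast; ring
    have := norm_sub_le (u + y * v) (u + x * v)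
    rw [← e, norm_mul, Complex.norm_real, Real.norm_eq_abs, abs_of_nonneg (by linarith)] at this
    linarith
  have hdv : d * ‖v‖ ≤ 160 * C := by nlinarith [norm_nonneg v]
  have hu : ‖u‖ ≤ 2 * C + x * ‖v‖ := by
    have e : u = (u + x * v) - x * v := by ring
    have := norm_sub_le (u + x * v) (x * v)
    rw [← e, norm_mul, Complex.norm_natCast] at this
    linarith
  have : (x : ℝ) * ‖v‖ ≤ d * ‖v‖ := by gcongr; linarith
  linarith

/-- Few bad indices leave a good start in every window of length `w`. Each good start bounds the
coefficient `u + k v` there, and two distant values of an affine function determine both of its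
coefficients. -/
lemma amp_le_of_good_starts {z u v : ℂ} {d δ : ℝ} {p l w : ℕ} (hd : 1 ≤ d) (hz : ‖z‖ ≤ 1)
    (hr : 1 - ‖z‖ ≤ 1 / d) (him : 1 / 100 ≤ |(z ^ (p * l)).im|) (hw : (w : ℝ) ≤ d / 20)
    (hw' : d / 40 ≤ w) (B S : Finset ℕ) (hcard : S.card * B.card < w)
    (hgood : ∀ x, x < 3 * w → (∀ i ∈ S, x + i ∉ B) →
      ∀ i ≤ 3, |linExp z u v (x + (p * l) * i)| ≤ δ) :
    ‖u‖ + d * ‖v‖ ≤ 10 ^ 10 * δ := by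
  -- The starts come from the first and third of three consecutive windows, so they differ by more
  -- than `w`.
  obtain ⟨x, -, hxw, hx⟩ := exists_translate_disjoint B S 0 w hcard
  obtain ⟨y, hyl, hyw, hy⟩ := exists_translate_disjoint B S (2 * w) w hcard
  have key : ∀ k, k < 3 * w → (∀ i ∈ S, k + i ∉ B) → ‖(u + k * v) * z ^ k‖ ≤ 21 * 10 ^ 6 * δ := by
    intro k hk hkS
    have := norm_le_of_linExp_small (ζ := z ^ (p * l)) (a := (u + k * v) * z ^ k)
      (b := ((p * l : ℕ) : ℂ) * v * z ^ k) (δ := δ) (by norm_num : (0 : ℝ) < 1 / 100)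
      (by rw [norm_pow]; exact pow_le_one₀ (norm_nonneg _) hz) him
      (by intro i hi; rw [← linExp_add_mul]; exact hgood k hk hkS i hi)
    refine this.trans (le_of_eq ?_)
    norm_num
    ring
  have hx' : (x : ℝ) < w := by exact_mod_cast (by omega : x < w)
  have hy' : (y : ℝ) < 3 * w := by exact_mod_cast (by omega : y < 3 * w)
  have hy2 : (2 : ℝ) * w ≤ y := by exact_mod_cast hyl
  have k1 := key x (by omega) hx
  have hδ : 0 ≤ δ := by nlinarith [(norm_nonneg _).trans k1]
  have := amp_le_of_two_points hd hr (x := x) (y := y) (by linarith) (by linarith) (by linarith)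
    k1 (key y (by omega) hy)
  nlinarith

/-- Nondegeneracy of the quadratic form. -/
lemma sum_linExp_sq_ge {z u v : ℂ} {d : ℝ} {p l m : ℕ} (hd : 100 ≤ d) (hz : ‖z‖ ≤ 1)
    (hr : 1 - ‖z‖ ≤ 1 / d) (him : 1 / 100 ≤ |(z ^ (p * l)).im|)
    (hpl : ((p * l : ℕ) : ℝ) ≤ d / 50) (hm : d / 4 ≤ m) :
    d * (‖u‖ + d * ‖v‖) ^ 2 / 10 ^ 25 ≤ ∑ k ∈ Finset.range m, linExp z u v k ^ 2 := by
  set R : ℝ := ‖u‖ + d * ‖v‖ with hR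
  have hR0 : 0 ≤ R := by positivity
  rcases hR0.eq_or_lt with h0 | hRpos
  · rw [← h0]; simp only [ne_eq, OfNat.ofNat_ne_zero, not_false_eq_true, zero_pow, mul_zero,
      zero_div]
    exact Finset.sum_nonneg fun _ _ => sq_nonneg _
  -- With this threshold, too few large values would give R ≤ R/2, a contradiction.
  set δ : ℝ := R / (2 * 10 ^ 10) with hδ
  have hδ0 : 0 < δ := by positivity
  set B : Finset ℕ := (Finset.range m).filter fun k => δ < |linExp z u v k| with hB
  set w : ℕ := ⌊d / 20⌋₊ with hw
  have hw1 : (w : ℝ) ≤ d / 20 := Nat.floor_le (by positivity)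
  have hw2 : d / 40 ≤ w := by
    have := Nat.lt_floor_add_one (d / 20)
    rw [← hw] at this
    linarith
  set S : Finset ℕ := (Finset.range 4).image fun i => p * l * i with hS
  have hBcard : w ≤ 4 * B.card := by
    by_contra! hlt
    have hScard : S.card ≤ 4 := Finset.card_image_le.trans (by simp)
    have := amp_le_of_good_starts (u := u) (v := v) (δ := δ) (by linarith) hz hr him hw1 hw2 B S
      (lt_of_le_of_lt (Nat.mul_le_mul_right _ hScard) hlt) (by
        intro x hx hxS i hi
        have h1 := hxS (p * l * i) (Finset.mem_image.2 ⟨i, Finset.mem_range.2 (by omega), rfl⟩)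
        rw [hB, Finset.mem_filter, not_and, not_lt] at h1
        apply h1
        rw [Finset.mem_range]
        have hx' : (x : ℝ) < 3 * w := by exact_mod_cast hx
        have hi' : (i : ℝ) ≤ 3 := by exact_mod_cast hi
        have : ((x + p * l * i : ℕ) : ℝ) < m := by
          rw [Nat.cast_add, Nat.cast_mul (p * l) i]
          have : ((p * l : ℕ) : ℝ) * i ≤ d / 50 * 3 := by gcongr
          linarith
        exact_mod_cast this)
    rw [← hR, hδ] at this
    have e : (10 : ℝ) ^ 10 * (R / (2 * 10 ^ 10)) = R / 2 := by ring
    linarith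
  have hBc : d / 160 ≤ B.card := by
    have : (w : ℝ) ≤ 4 * B.card := by exact_mod_cast hBcard
    linarith
  calc d * R ^ 2 / 10 ^ 25 ≤ d / 160 * δ ^ 2 := by
        rw [hδ, div_pow]
        have : 0 ≤ d * R ^ 2 := by positivity
        have e : d / 160 * (R ^ 2 / (2 * 10 ^ 10) ^ 2) = d * R ^ 2 / (160 * (2 * 10 ^ 10) ^ 2) := by
          ring
        rw [e]
        gcongr
        norm_num
    _ ≤ B.card * δ ^ 2 := by gcongr
    _ = ∑ k ∈ B, δ ^ 2 := by rw [Finset.sum_const, nsmul_eq_mul]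
    _ ≤ ∑ k ∈ B, linExp z u v k ^ 2 := by
        refine Finset.sum_le_sum fun k hk => ?_
        rw [hB, Finset.mem_filter] at hk
        rw [← sq_abs (linExp z u v k)]
        exact pow_le_pow_left₀ hδ0.le hk.2.le 2
    _ ≤ _ := Finset.sum_le_sum_of_subset_of_nonneg (Finset.filter_subset _ _)
        fun _ _ _ => sq_nonneg _

/-- If the sum were below `G`, at most G/δ² indices would be farther than δ from the integers. The
progressions needed have at most 4l + j + 1 points, and `hG` lets the union bound avoid all the bad
indices. The values on them are then small, which contradicts `hamp'`. -/
lemma sum_dist_int_sq_ge {z u v : ℂ} {A d σ δ G : ℝ} {p l m j : ℕ} (hd : 100 ≤ d) (hz : ‖z‖ ≤ 1)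
    (hr : 1 - ‖z‖ ≤ 1 / d) (hA : 100 ≤ A) (hσ : |σ| = 1) (hpA : (p : ℝ) ≤ A)
    (hl : (l : ℝ) ≤ d / A) (hρ : ‖(σ : ℂ) * z ^ p - 1‖ + p / d ≤ 8 / A)
    (him : 1 / 100 ≤ |(z ^ (p * l)).im|)
    (hpl : ((p * l : ℕ) : ℝ) ≤ d / 50) (hm : d / 4 ≤ m)
    (hj : A * j ≤ d / 100) (hamp : (8 / A) ^ j * (‖u‖ + d * ‖v‖) ≤ 1 / 4)
    (hδ0 : 0 < δ) (hδ : 32 * (2 ^ j * δ) ≤ (1 / 100) ^ 4)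
    (hG : (4 * (d / A) + j + 1) * (G / δ ^ 2) < d / 40) (hamp' : 10 ^ 10 * δ < ‖u‖ + d * ‖v‖) :
    G ≤ ∑ k ∈ Finset.range m, |linExp z u v k - round (linExp z u v k)| ^ 2 := by
  by_contra! hlt
  set B : Finset ℕ := (Finset.range m).filter
    fun k => δ < |linExp z u v k - round (linExp z u v k)| with hB
  have hBc : (B.card : ℝ) ≤ G / δ ^ 2 := by
    rw [le_div_iff₀ (by positivity)]
    refine le_trans ?_ hlt.le
    calc _ = ∑ k ∈ B, δ ^ 2 := by rw [Finset.sum_const, nsmul_eq_mul]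
      _ ≤ ∑ k ∈ B, |linExp z u v k - round (linExp z u v k)| ^ 2 := by
        refine Finset.sum_le_sum fun k hk => ?_
        rw [hB, Finset.mem_filter] at hk
        exact pow_le_pow_left₀ hδ0.le hk.2.le 2
      _ ≤ _ := Finset.sum_le_sum_of_subset_of_nonneg (Finset.filter_subset _ _)
        fun _ _ _ => by positivity
  set w : ℕ := ⌊d / 20⌋₊ with hw
  have hw1 : (w : ℝ) ≤ d / 20 := Nat.floor_le (by positivity)
  have hw2 : d / 40 ≤ w := by
    have := Nat.lt_floor_add_one (d / 20)
    rw [← hw] at this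
    linarith
  set S : Finset ℕ := (Finset.range (4 * l + j + 1)).image fun i => p * i with hS
  have hcard : S.card * B.card < w := by
    have h1 : S.card ≤ 4 * l + j + 1 := Finset.card_image_le.trans (by simp)
    have h2 : (S.card : ℝ) ≤ 4 * (d / A) + j + 1 := by
      have : (S.card : ℝ) ≤ 4 * l + j + 1 := by exact_mod_cast h1
      linarith
    have : (S.card : ℝ) * B.card < w := by
      calc (S.card : ℝ) * B.card ≤ (4 * (d / A) + j + 1) * (G / δ ^ 2) := by gcongr
        _ < w := by linarith
    exact_mod_cast this
  refine absurd (amp_le_of_good_starts (u := u) (v := v) (δ := δ) (by linarith) hz hr him hw1 hw2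
    B S hcard ?_) (not_le.2 hamp')
  intro x hx hxS i hi
  have hx' : (x : ℝ) < 3 * w := by exact_mod_cast hx
  rw [mul_assoc]
  have hpl' : (p : ℝ) * l ≤ d / 50 := by exact_mod_cast hpl
  refine linExp_small_of_near_int (c := 1 / 100) (d := d) (ρ := 8 / A) (by norm_num) (by linarith)
    hz him hσ hρ (by positivity) ?_ j u v δ hamp hδ ?_ (l * i) (by nlinarith)
  · push_cast
    linarith
  · intro i hi
    refine ⟨round (linExp z u v (x + p * i)), ?_⟩
    have h1 := hxS (p * i) (Finset.mem_image.2 ⟨i, Finset.mem_range.2 (by omega), rfl⟩)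
    rw [hB, Finset.mem_filter, not_and, not_lt] at h1
    apply h1
    rw [Finset.mem_range]
    have : ((x + p * i : ℕ) : ℝ) < m := by
      push_cast
      have hi' : (i : ℝ) ≤ 4 * l + j := by exact_mod_cast hi
      have h1 : (p : ℝ) * i ≤ p * (4 * l + j) := by gcongr
      have h2 : (p : ℝ) * j ≤ A * j := by gcongr
      linarith
    exact_mod_cast this

/-! ### Lower bounds at smooth points of large effective degree -/

lemma eventually_const_mul_rpow_lt (K : ℝ) {e f : ℝ} (h : e < f) :
    ∀ᶠ d : ℝ in Filter.atTop, K * d ^ e < d ^ f := by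
  filter_upwards [(tendsto_rpow_atTop (sub_pos.2 h)).eventually_gt_atTop K,
    Filter.eventually_gt_atTop 0] with d h1 h2
  have : d ^ f = d ^ (f - e) * d ^ e := by rw [← Real.rpow_add h2]; ring_nf
  rw [this]
  exact mul_lt_mul_of_pos_right h1 (Real.rpow_pos_of_pos h2 _)

/-- The choice of parameters: A = d^{7τ}, δ = d^{-2τ}, G = d^τ. The union bound costs about (d/A)
G/δ² = d^{1-2τ}, which is below d. -/
lemma eventually_sum_lower_bounds {τ c' : ℝ} (hτ : 0 < τ) (hτ' : τ ≤ 1 / 10 ^ 4) (hc' : 0 < c') :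
    ∀ᶠ d : ℝ in Filter.atTop, ∀ z : ℂ, ‖z‖ ≤ 1 → 1 - ‖z‖ ≤ 1 / d →
      (∀ p : ℤ, 1 ≤ p → (p : ℝ) ≤ d ^ (7 * τ) + 1 →
        d ^ (7 * τ) / d ≤ ‖((p * z.arg / Real.pi : ℝ) : UnitAddCircle)‖) →
      ∀ m : ℕ, d / 4 ≤ m → ∀ u v : ℂ,
        d * (‖u‖ + d * ‖v‖) ^ 2 / 10 ^ 25 ≤ ∑ k ∈ Finset.range m, linExp z u v k ^ 2 ∧
        (c' ≤ ‖u‖ + d * ‖v‖ → ‖u‖ + d * ‖v‖ ≤ d ^ 3 → d ^ τ ≤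
          ∑ k ∈ Finset.range m, |linExp z u v k - round (linExp z u v k)| ^ 2) := by
  -- Then A^j ≥ d⁷, more than enough to bring an amplitude of d³ below 1/4.
  set j : ℕ := ⌈1 / τ⌉₊ with hj
  have hj1 : 1 ≤ τ * j := by
    have := Nat.le_ceil (1 / τ)
    rw [← hj, div_le_iff₀ hτ] at this
    linarith
  filter_upwards [Filter.eventually_ge_atTop 100,
    eventually_const_mul_rpow_lt 100 (show (0 : ℝ) < 7 * τ by linarith),
    eventually_const_mul_rpow_lt 1000 (show 14 * τ < (1 : ℝ) by linarith),
    eventually_const_mul_rpow_lt (100 * j) (show 7 * τ < (1 : ℝ) by linarith),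
    eventually_const_mul_rpow_lt (4 * 8 ^ j) (show (3 : ℝ) < 7 by norm_num),
    eventually_const_mul_rpow_lt (32 * 2 ^ j * 100 ^ 4) (show -(2 * τ) < (0 : ℝ) by linarith),
    eventually_const_mul_rpow_lt 320 (show 1 - 2 * τ < (1 : ℝ) by linarith),
    eventually_const_mul_rpow_lt (80 * (j + 1)) (show 5 * τ < (1 : ℝ) by linarith),
    eventually_const_mul_rpow_lt (10 ^ 10 / c') (show -(2 * τ) < (0 : ℝ) by linarith)]
    with d h1 h2 h3 h4 h5 h6 h7 h8 h9
  intro z hz hr hs m hm u v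
  have hd0 : 0 < d := by linarith
  simp only [Real.rpow_zero, Real.rpow_one, mul_one] at h2 h3 h4 h6 h7 h8 h9
  set A : ℝ := d ^ (7 * τ) with hA
  have hA0 : 0 < A := by positivity
  obtain ⟨p, l, σ, hσ, hpA, hl, hpl, hρ, him⟩ := exists_progression_of_smooth hz h2.le (d := d)
    (by
      have : A ^ 2 = d ^ (14 * τ) := by
        rw [hA, ← Real.rpow_natCast, ← Real.rpow_mul hd0.le]; ring_nf
      rw [this]; exact h3.le) hr hs
  refine ⟨sum_linExp_sq_ge h1 hz hr him hpl hm, fun hlow hup => ?_⟩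
  have hδ0 : 0 < d ^ (-(2 * τ)) := by positivity
  refine sum_dist_int_sq_ge (j := j) (δ := d ^ (-(2 * τ))) h1 hz hr h2.le hσ hpA hl hρ him hpl hm
    (by linarith) ?_ hδ0 ?_ ?_ ?_
  · have hAj : d ^ (7 : ℝ) ≤ A ^ j := by
      rw [hA, ← Real.rpow_natCast, ← Real.rpow_mul hd0.le]
      exact Real.rpow_le_rpow_of_exponent_le (by linarith) (by linarith)
    have h5' : 4 * 8 ^ j * d ^ 3 < d ^ (7 : ℝ) := by
      have : d ^ (3 : ℝ) = d ^ 3 := by rw [← Real.rpow_natCast]; norm_num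
      rwa [this] at h5
    rw [div_pow, div_mul_eq_mul_div, div_le_iff₀ (by positivity)]
    calc (8 : ℝ) ^ j * (‖u‖ + d * ‖v‖) ≤ 8 ^ j * d ^ 3 := by gcongr
      _ = 1 / 4 * (4 * 8 ^ j * d ^ 3) := by ring
      _ ≤ 1 / 4 * A ^ j := mul_le_mul_of_nonneg_left (h5'.le.trans hAj) (by norm_num)
  · have e : (1 / 100 : ℝ) ^ 4 = 1 / 100 ^ 4 := by norm_num
    rw [e, le_div_iff₀ (by positivity)]
    linarith
  · have e1 : d ^ τ / (d ^ (-(2 * τ))) ^ 2 = d ^ (5 * τ) := by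
      rw [← Real.rpow_natCast, ← Real.rpow_mul hd0.le, ← Real.rpow_sub hd0]
      congr 1; push_cast; ring
    have e2 : d / A * d ^ (5 * τ) = d ^ (1 - 2 * τ) := by
      have : d / A = d ^ (1 - 7 * τ) := by rw [Real.rpow_sub hd0, Real.rpow_one]
      rw [this, ← Real.rpow_add hd0]; ring_nf
    rw [e1]
    have : (4 * (d / A) + j + 1) * d ^ (5 * τ) =
        4 * d ^ (1 - 2 * τ) + (j + 1) * d ^ (5 * τ) := by
      rw [← e2]; ring
    rw [this]
    linarith
  · rw [div_mul_eq_mul_div, div_lt_one hc'] at h9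
    linarith

/-! ### Characteristic functions -/

/-- By periodicity the right side is 2 sin²(πy), where y is the distance to the nearest integer, and
Jordan's inequality gives sin(πy) ≥ 2y. -/
lemma eight_mul_dist_int_sq_le (x : ℝ) : 8 * |x - round x| ^ 2 ≤ 1 - Real.cos (2 * Real.pi * x) := by
  set y := x - round x with hy
  have hcos : Real.cos (2 * Real.pi * x) = Real.cos (2 * (Real.pi * |y|)) := by
    have e : 2 * Real.pi * x = 2 * (Real.pi * y) + (round x : ℤ) * (2 * Real.pi) := by
      rw [hy]; ring
    rw [e, Real.cos_add_int_mul_two_pi]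
    rcases abs_cases y with h | h <;> rw [h.1]
    rw [mul_neg, mul_neg, Real.cos_neg]
  rw [hcos, Real.cos_two_mul, ← sub_nonneg]
  have hpi := Real.pi_pos
  have hy2 : |y| ≤ 1 / 2 := abs_sub_round x
  have h1 := Real.mul_le_sin (x := Real.pi * |y|) (by positivity) (by nlinarith)
  have h2 : 2 / Real.pi * (Real.pi * |y|) = 2 * |y| := by field_simp
  rw [h2] at h1
  have h3 : (2 * |y|) ^ 2 ≤ Real.sin (Real.pi * |y|) ^ 2 := pow_le_pow_left₀ (by positivity) h1 2
  nlinarith [Real.sin_sq_add_cos_sq (Real.pi * |y|)]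

/-- Symmetrization: the squared modulus is the characteristic function of the difference of two
independent copies. -/
lemma norm_charFun_sq_eq (ν : Measure ℝ) [IsProbabilityMeasure ν] (s : ℝ) :
    ‖charFun ν s‖ ^ 2 = ∫ q : ℝ × ℝ, Real.cos (s * (q.1 - q.2)) ∂(ν.prod ν) := by
  have hint : Integrable (fun x : ℝ => Complex.exp (s * x * Complex.I)) ν := by
    refine Integrable.of_bound (C := 1) (by fun_prop) (ae_of_all _ fun x => ?_)
    rw [← Complex.ofReal_mul, Complex.norm_exp_ofReal_mul_I]
  have e1 : charFun ν s = ∫ x, Complex.exp (s * x * Complex.I) ∂ν := charFun_apply_real s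
  have hcos : Integrable (fun x => Real.cos (s * x)) ν :=
    Integrable.of_bound (C := 1) (by fun_prop) (ae_of_all _ fun x => Real.abs_cos_le_one _)
  have hsin : Integrable (fun x => Real.sin (s * x)) ν :=
    Integrable.of_bound (C := 1) (by fun_prop) (ae_of_all _ fun x => Real.abs_sin_le_one _)
  have hre : (charFun ν s).re = ∫ x, Real.cos (s * x) ∂ν := by
    rw [e1]
    have := integral_re (𝕜 := ℂ) hint
    simp only [RCLike.re_eq_complex_re] at this
    rw [← this]
    refine integral_congr_ae (ae_of_all _ fun x => ?_)
    simp only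
    rw [← Complex.ofReal_mul, Complex.exp_ofReal_mul_I_re]
  have him : (charFun ν s).im = ∫ x, Real.sin (s * x) ∂ν := by
    rw [e1]
    have := integral_im (𝕜 := ℂ) hint
    simp only [RCLike.im_eq_complex_im] at this
    rw [← this]
    refine integral_congr_ae (ae_of_all _ fun x => ?_)
    simp only
    rw [← Complex.ofReal_mul, Complex.exp_ofReal_mul_I_im]
  rw [← Complex.normSq_eq_norm_sq, Complex.normSq_apply, hre, him, ← integral_prod_mul,
    ← integral_prod_mul, ← integral_add (hcos.mul_prod hcos) (hsin.mul_prod hsin)]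
  refine integral_congr_ae (ae_of_all _ fun q => ?_)
  simp only
  rw [mul_sub, Real.cos_sub]

/-- A mean-zero law without an atom at `0` has differences bounded away from `0` and `∞` with
positive probability. -/
lemma exists_symmetrized_mass {ν : Measure ℝ} [IsProbabilityMeasure ν]
    (hint : Integrable (fun x : ℝ => x) ν) (hmean : ∫ x, x ∂ν = 0) (h0 : ν {0} = 0) :
    ∃ a b : ℝ, 0 < a ∧ a ≤ b ∧
      0 < (ν.prod ν).real {q : ℝ × ℝ | q.1 - q.2 ∈ Set.Icc a b} := by
  have hne : ¬ (∀ᵐ x ∂ν, x = 0) := by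
    intro h
    have h1 : ν {0}ᶜ = 0 := h
    have h2 := measure_add_measure_compl (μ := ν) (measurableSet_singleton (0 : ℝ))
    rw [h0, h1, measure_univ] at h2
    simp at h2
  -- Mean zero forces mass on both sides of the origin, since a one-sided law of mean zero is
  -- concentrated at 0.
  have hpos : ν (Set.Ioi 0) ≠ 0 := by
    intro h
    have hle : ∀ᵐ x ∂ν, 0 ≤ -x := by
      have : ∀ᵐ x ∂ν, x ∉ Set.Ioi (0 : ℝ) := measure_eq_zero_iff_ae_notMem.1 h
      filter_upwards [this] with x hx
      simp only [Set.mem_Ioi, not_lt] at hx; linarith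
    have := (integral_eq_zero_iff_of_nonneg_ae hle hint.neg).1 (by
      rw [integral_neg, hmean, neg_zero])
    exact hne (by filter_upwards [this] with x hx; simpa using hx)
  have hneg : ν (Set.Iio 0) ≠ 0 := by
    intro h
    have hle : ∀ᵐ x ∂ν, 0 ≤ x := by
      have : ∀ᵐ x ∂ν, x ∉ Set.Iio (0 : ℝ) := measure_eq_zero_iff_ae_notMem.1 h
      filter_upwards [this] with x hx
      simpa using hx
    have := (integral_eq_zero_iff_of_nonneg_ae hle hint).1 hmean
    exact hne (by filter_upwards [this] with x hx; simpa using hx)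
  obtain ⟨k, hk⟩ : ∃ k : ℕ, ν (Set.Icc (1 / ((k : ℝ) + 1)) (k + 1)) ≠ 0 := by
    by_contra! hcon
    apply hpos
    refine measure_mono_null ?_ (measure_iUnion_null hcon)
    intro x hx
    rw [Set.mem_iUnion]
    have hx : 0 < x := hx
    obtain ⟨k, hk⟩ := exists_nat_ge (max x (1 / x))
    refine ⟨k, ?_, ?_⟩
    · rw [div_le_iff₀ (by positivity)]
      have := (le_max_right x (1 / x)).trans hk
      rw [div_le_iff₀ hx] at this
      nlinarith
    · have := (le_max_left x (1 / x)).trans hk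
      linarith
  obtain ⟨i, hi⟩ : ∃ i : ℕ, ν (Set.Icc (-(i : ℝ)) 0) ≠ 0 := by
    by_contra! hcon
    apply hneg
    refine measure_mono_null ?_ (measure_iUnion_null hcon)
    intro x hx
    rw [Set.mem_iUnion]
    obtain ⟨i, hi⟩ := exists_nat_ge (-x)
    exact ⟨i, by linarith, le_of_lt hx⟩
  refine ⟨1 / ((k : ℝ) + 1), k + 1 + i, by positivity, ?_, ?_⟩
  · have : 1 / ((k : ℝ) + 1) ≤ 1 := by
      rw [div_le_one (by positivity)]; linarith [Nat.cast_nonneg (α := ℝ) k]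
    linarith [Nat.cast_nonneg (α := ℝ) k, Nat.cast_nonneg (α := ℝ) i]
  · refine ENNReal.toReal_pos ?_ (measure_ne_top _ _)
    have hprod : (ν.prod ν) (Set.Icc (1 / ((k : ℝ) + 1)) (k + 1) ×ˢ Set.Icc (-(i : ℝ)) 0) ≠ 0 := by
      rw [Measure.prod_prod]; exact mul_ne_zero hk hi
    refine ne_of_gt (lt_of_lt_of_le (pos_iff_ne_zero.2 hprod) (measure_mono ?_))
    rintro ⟨x, y⟩ ⟨⟨h1, h2⟩, h3, h4⟩
    simp only [Set.mem_ofPred_eq, Set.mem_Icc] at *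
    constructor <;> linarith

/-- From |φ|² ≤ exp(-(1 - |φ|²)), the logarithm of the product is controlled by the averages of 1 -
cos over the symmetrized law. Only differences in [a, b] are kept. -/
lemma prod_norm_charFun_le {ν : Measure ℝ} [IsProbabilityMeasure ν] {a b G : ℝ} {ι : Type*}
    (J : Finset ι) (s : ι → ℝ)
    (hG : ∀ w ∈ Set.Icc a b, G ≤ ∑ k ∈ J, (1 - Real.cos (s k * w))) :
    ∏ k ∈ J, ‖charFun ν (s k)‖ ≤
      Real.exp (-((ν.prod ν).real {q : ℝ × ℝ | q.1 - q.2 ∈ Set.Icc a b} * G / 2)) := by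
  set W : Set (ℝ × ℝ) := {q : ℝ × ℝ | q.1 - q.2 ∈ Set.Icc a b} with hW
  have hWm : MeasurableSet W := measurableSet_Icc.preimage (by fun_prop)
  have hcos : ∀ t : ℝ, Integrable (fun q : ℝ × ℝ => 1 - Real.cos (t * (q.1 - q.2))) (ν.prod ν) := by
    intro t
    refine (integrable_const _).sub (Integrable.of_bound (C := 1) (by fun_prop)
      (ae_of_all _ fun x => Real.abs_cos_le_one _))
  have h1 : ∀ t : ℝ, 1 - ‖charFun ν t‖ ^ 2 =
      ∫ q : ℝ × ℝ, (1 - Real.cos (t * (q.1 - q.2))) ∂(ν.prod ν) := by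
    intro t
    rw [norm_charFun_sq_eq, integral_sub (integrable_const _) (Integrable.of_bound (C := 1)
      (by fun_prop) (ae_of_all _ fun x => Real.abs_cos_le_one _))]
    simp
  have h2 : ∀ t : ℝ, ‖charFun ν t‖ ≤ Real.exp (-((1 - ‖charFun ν t‖ ^ 2) / 2)) := by
    intro t
    have h3 : ‖charFun ν t‖ ^ 2 ≤ Real.exp (-((1 - ‖charFun ν t‖ ^ 2) / 2)) ^ 2 := by
      rw [← Real.exp_nat_mul]
      have := Real.add_one_le_exp (-(1 - ‖charFun ν t‖ ^ 2))
      have e : ((2 : ℕ) : ℝ) * -((1 - ‖charFun ν t‖ ^ 2) / 2) = -(1 - ‖charFun ν t‖ ^ 2) := by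
        push_cast; ring
      rw [e]; linarith
    exact le_of_sq_le_sq h3 (Real.exp_pos _).le
  have h3 : (ν.prod ν).real W * G ≤ ∑ k ∈ J, (1 - ‖charFun ν (s k)‖ ^ 2) := by
    simp_rw [h1]
    rw [← integral_finsetSum J fun k _ => hcos (s k)]
    calc (ν.prod ν).real W * G = ∫ q in W, G ∂(ν.prod ν) := by
          rw [setIntegral_const, smul_eq_mul]
      _ ≤ ∫ q in W, ∑ k ∈ J, (1 - Real.cos (s k * (q.1 - q.2))) ∂(ν.prod ν) := by
          refine setIntegral_mono_on (integrable_const _).integrableOn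
            (integrable_finsetSum J fun k _ => hcos (s k)).integrableOn hWm ?_
          intro q hq
          exact hG _ hq
      _ ≤ _ := by
          refine setIntegral_le_integral (integrable_finsetSum J fun k _ => hcos (s k))
            (ae_of_all _ fun q => Finset.sum_nonneg fun k _ => ?_)
          linarith [Real.cos_le_one (s k * (q.1 - q.2))]
  calc _ ≤ ∏ k ∈ J, Real.exp (-((1 - ‖charFun ν (s k)‖ ^ 2) / 2)) :=
        Finset.prod_le_prod (fun _ _ => norm_nonneg _) fun k _ => h2 (s k)
    _ = Real.exp (-(∑ k ∈ J, (1 - ‖charFun ν (s k)‖ ^ 2) / 2)) := by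
        rw [← Real.exp_sum, Finset.sum_neg_distrib]
    _ ≤ _ := by
        rw [Real.exp_le_exp, ← Finset.sum_div]
        linarith

/-! ### A small-ball inequality by Gaussian smoothing -/

lemma integral_gaussian_mul_exp_inner {a : ℝ} (ha : 0 < a) (w : ℂ) :
    ∫ v : ℂ, Complex.exp (-((a ^ 2 / 4 : ℝ) : ℂ) * ‖v‖ ^ 2 + Complex.I * (inner ℝ w v : ℝ)) =
      ((4 * Real.pi / a ^ 2 * Real.exp (-(‖w‖ ^ 2 / a ^ 2)) : ℝ) : ℂ) := by
  have hb : 0 < (((a ^ 2 / 4 : ℝ) : ℂ)).re := by rw [Complex.ofReal_re]; positivity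
  have h := GaussianFourier.integral_cexp_neg_mul_sq_norm_add (V := ℂ) hb Complex.I w
  rw [h, Complex.finrank_real_complex]
  have ha' : (a : ℂ) ≠ 0 := by exact_mod_cast ha.ne'
  push_cast
  rw [div_self (two_ne_zero), Complex.cpow_one, Complex.I_sq]
  congr 1
  · field_simp
  · congr 1; field_simp

lemma integrable_exp_neg_mul_norm_sq {c : ℝ} (hc : 0 < c) :
    Integrable fun v : ℂ => Real.exp (-c * ‖v‖ ^ 2) := by
  have hb : 0 < ((c : ℂ)).re := by rw [Complex.ofReal_re]; positivity
  refine (GaussianFourier.integrable_cexp_neg_mul_sq_norm_add (V := ℂ) hb 0 0).norm.congr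
    (ae_of_all _ fun v => ?_)
  simp only [zero_mul, add_zero]
  rw [Complex.norm_exp]
  congr 1
  rw [← Complex.ofReal_neg, ← Complex.ofReal_pow, ← Complex.ofReal_mul, Complex.ofReal_re]

lemma integral_exp_neg_mul_norm_sq {c : ℝ} (hc : 0 < c) :
    ∫ v : ℂ, Real.exp (-c * ‖v‖ ^ 2) = Real.pi / c := by
  rw [GaussianFourier.integral_rexp_neg_mul_sq_norm hc, Complex.finrank_real_complex]
  norm_num

lemma integrable_gaussian_prod {c e : ℝ} (hc : 0 < c) (he : 0 < e) :
    Integrable fun η : ℂ × ℂ => Real.exp (-c * ‖η.1‖ ^ 2) * Real.exp (-e * ‖η.2‖ ^ 2) :=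
  (integrable_exp_neg_mul_norm_sq hc).mul_prod (integrable_exp_neg_mul_norm_sq he)

lemma integral_gaussian_prod {c e : ℝ} (hc : 0 < c) (he : 0 < e) :
    ∫ η : ℂ × ℂ, Real.exp (-c * ‖η.1‖ ^ 2) * Real.exp (-e * ‖η.2‖ ^ 2) =
      Real.pi / c * (Real.pi / e) := by
  rw [← integral_exp_neg_mul_norm_sq hc, ← integral_exp_neg_mul_norm_sq he]
  exact integral_prod_mul (μ := (volume : Measure ℂ)) (ν := (volume : Measure ℂ))
    (fun v => Real.exp (-c * ‖v‖ ^ 2)) (fun v => Real.exp (-e * ‖v‖ ^ 2))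

/-- The indicator of the two balls is at most e² times a Gaussian bump, which is itself a
Gaussian-weighted integral of characters. Fubini moves the expectation inside; the centres α, β
contribute only a phase and disappear under the norm. -/
lemma measureReal_small_ball_le {Ω : Type*} [MeasurableSpace Ω] {μ : Measure Ω}
    [IsProbabilityMeasure μ] {U V : Ω → ℂ} (hU : Measurable U) (hV : Measurable V) {F : Set Ω}
    (hF : MeasurableSet F) {a b : ℝ} (ha : 0 < a) (hb : 0 < b) (α β : ℂ) {M : ℂ × ℂ → ℝ}
    (hM : ∀ η : ℂ × ℂ, Real.exp (-(a ^ 2 / 4) * ‖η.1‖ ^ 2) * Real.exp (-(b ^ 2 / 4) * ‖η.2‖ ^ 2) *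
      ‖∫ ω in F, Complex.exp (((inner ℝ (U ω) η.1 + inner ℝ (V ω) η.2 : ℝ) : ℂ) * Complex.I) ∂μ‖
        ≤ M η)
    (hMi : Integrable M) :
    μ.real ({ω | ‖U ω - α‖ ≤ a ∧ ‖V ω - β‖ ≤ b} ∩ F) ≤
      Real.exp 2 * (a ^ 2 * b ^ 2 / (16 * Real.pi ^ 2)) * ∫ η, M η := by
  set Q : Ω → ℝ := fun ω => Real.exp (-(‖U ω - α‖ ^ 2 / a ^ 2)) * Real.exp (-(‖V ω - β‖ ^ 2 / b ^ 2))
    with hQ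
  have hQm : Measurable Q := by fun_prop
  have hQ0 : ∀ ω, 0 ≤ Q ω := fun ω => by positivity
  have hQ1 : ∀ ω, Q ω ≤ 1 := fun ω => by
    refine mul_le_one₀ ?_ (Real.exp_pos _).le ?_ <;> rw [Real.exp_le_one_iff, neg_nonpos] <;>
      positivity
  have hQi : Integrable Q μ := Integrable.of_bound (C := 1) hQm.aestronglyMeasurable
    (ae_of_all _ fun ω => by rw [Real.norm_eq_abs, abs_of_nonneg (hQ0 ω)]; exact hQ1 ω)
  set E : Set Ω := {ω | ‖U ω - α‖ ≤ a ∧ ‖V ω - β‖ ≤ b} with hE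
  have hEm : MeasurableSet E := by
    have h1 : MeasurableSet {ω | ‖U ω - α‖ ≤ a} := measurableSet_le (by fun_prop) measurable_const
    have h2 : MeasurableSet {ω | ‖V ω - β‖ ≤ b} := measurableSet_le (by fun_prop) measurable_const
    exact h1.inter h2
  have step1 : μ.real (E ∩ F) ≤ Real.exp 2 * ∫ ω in F, Q ω ∂μ := by
    have h1 : μ.real (E ∩ F) * Real.exp (-2) ≤ ∫ ω in E ∩ F, Q ω ∂μ := by
      rw [← smul_eq_mul, ← setIntegral_const]
      refine setIntegral_mono_on (integrable_const _).integrableOn hQi.integrableOn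
        (hEm.inter hF) ?_
      rintro ω ⟨⟨h1, h2⟩, -⟩
      rw [hQ]
      simp only
      rw [← Real.exp_add, Real.exp_le_exp]
      have e1 : ‖U ω - α‖ ^ 2 / a ^ 2 ≤ 1 := by
        rw [div_le_one (by positivity)]; gcongr
      have e2 : ‖V ω - β‖ ^ 2 / b ^ 2 ≤ 1 := by
        rw [div_le_one (by positivity)]; gcongr
      linarith
    have h2 : ∫ ω in E ∩ F, Q ω ∂μ ≤ ∫ ω in F, Q ω ∂μ :=
      setIntegral_mono_set hQi.integrableOn (ae_of_all _ hQ0)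
        (Filter.Eventually.of_forall fun ω hω => hω.2)
    have h3 : Real.exp 2 * Real.exp (-2) = 1 := by rw [← Real.exp_add]; simp
    have := mul_le_mul_of_nonneg_left (h1.trans h2) (Real.exp_pos 2).le
    calc _ = Real.exp 2 * (μ.real (E ∩ F) * Real.exp (-2)) := by
          rw [mul_left_comm, h3, mul_one]
      _ ≤ _ := this
  refine step1.trans ?_
  rw [mul_assoc]
  refine mul_le_mul_of_nonneg_left ?_ (Real.exp_pos 2).le
  -- the Fourier representation of the smoothed indicator
  set gA : Ω → ℂ → ℂ := fun ω v => Complex.exp (-((a ^ 2 / 4 : ℝ) : ℂ) * ‖v‖ ^ 2 +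
    Complex.I * (inner ℝ (U ω - α) v : ℝ)) with hgA
  set gB : Ω → ℂ → ℂ := fun ω v => Complex.exp (-((b ^ 2 / 4 : ℝ) : ℂ) * ‖v‖ ^ 2 +
    Complex.I * (inner ℝ (V ω - β) v : ℝ)) with hgB
  have hnorm : ∀ (c : ℝ) (w v : ℂ), ‖Complex.exp (-((c ^ 2 / 4 : ℝ) : ℂ) * ‖v‖ ^ 2 +
      Complex.I * (inner ℝ w v : ℝ))‖ = Real.exp (-(c ^ 2 / 4) * ‖v‖ ^ 2) := by
    intro c w v
    rw [Complex.norm_exp]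
    congr 1
    rw [← Complex.ofReal_neg, ← Complex.ofReal_pow, ← Complex.ofReal_mul, Complex.add_re,
      Complex.ofReal_re, mul_comm Complex.I, Complex.re_ofReal_mul, Complex.I_re, mul_zero,
      add_zero]
  set W : ℂ × ℂ → ℝ := fun η =>
    Real.exp (-(a ^ 2 / 4) * ‖η.1‖ ^ 2) * Real.exp (-(b ^ 2 / 4) * ‖η.2‖ ^ 2) with hW
  have hWi : Integrable W := integrable_gaussian_prod (by positivity) (by positivity)
  have hrep : ∀ ω, ∫ η : ℂ × ℂ, gA ω η.1 * gB ω η.2 =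
      ((16 * Real.pi ^ 2 / (a ^ 2 * b ^ 2) * Q ω : ℝ) : ℂ) := by
    intro ω
    have := integral_prod_mul (μ := (volume : Measure ℂ)) (ν := (volume : Measure ℂ))
      (gA ω) (gB ω)
    rw [← Measure.volume_eq_prod] at this
    rw [this, hgA, hgB]
    simp only
    rw [integral_gaussian_mul_exp_inner ha, integral_gaussian_mul_exp_inner hb,
      ← Complex.ofReal_mul, hQ]
    congr 1
    field_simp
    ring
  have hgm : Measurable fun q : Ω × (ℂ × ℂ) => gA q.1 q.2.1 * gB q.1 q.2.2 := by
    simp only [hgA, hgB]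
    fun_prop
  have hgn : ∀ q : Ω × (ℂ × ℂ), ‖gA q.1 q.2.1 * gB q.1 q.2.2‖ = W q.2 := by
    intro q
    rw [norm_mul, hgA, hgB]
    simp only
    rw [hnorm, hnorm]
  have hgi : Integrable (fun q : Ω × (ℂ × ℂ) => gA q.1 q.2.1 * gB q.1 q.2.2)
      ((μ.restrict F).prod volume) := by
    refine Integrable.mono' (g := fun q => W q.2) (hWi.comp_snd _) hgm.aestronglyMeasurable
      (ae_of_all _ fun q => (hgn q).le)
  have hswap := integral_integral_swap (μ := μ.restrict F) (ν := (volume : Measure (ℂ × ℂ)))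
    (f := fun ω η => gA ω η.1 * gB ω η.2) hgi
  simp_rw [hrep] at hswap
  rw [integral_complex_ofReal, integral_const_mul] at hswap
  have hinner : ∀ η : ℂ × ℂ, ‖∫ ω in F, gA ω η.1 * gB ω η.2 ∂μ‖ ≤ M η := by
    intro η
    refine le_trans (le_of_eq ?_) (hM η)
    have e : ∀ ω, gA ω η.1 * gB ω η.2 =
        ((W η : ℂ) * Complex.exp (((-(inner ℝ α η.1) - inner ℝ β η.2 : ℝ) : ℂ) * Complex.I)) *
        Complex.exp (((inner ℝ (U ω) η.1 + inner ℝ (V ω) η.2 : ℝ) : ℂ) * Complex.I) := by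
      intro ω
      simp only [hgA, hgB, hW]
      rw [Complex.ofReal_mul, Complex.ofReal_exp, Complex.ofReal_exp, ← Complex.exp_add,
        ← Complex.exp_add, ← Complex.exp_add, ← Complex.exp_add, inner_sub_left, inner_sub_left]
      congr 1
      push_cast
      ring
    simp_rw [e]
    rw [integral_const_mul, norm_mul, norm_mul, Complex.norm_exp_ofReal_mul_I, mul_one,
      Complex.norm_real, Real.norm_eq_abs, abs_of_nonneg (by positivity)]
  have hfin : 16 * Real.pi ^ 2 / (a ^ 2 * b ^ 2) * ∫ ω in F, Q ω ∂μ ≤ ∫ η, M η := by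
    have h1 : 0 ≤ ∫ ω in F, Q ω ∂μ := integral_nonneg hQ0
    have hx : 0 ≤ 16 * Real.pi ^ 2 / (a ^ 2 * b ^ 2) * ∫ ω in F, Q ω ∂μ := by positivity
    calc _ = ‖((16 * Real.pi ^ 2 / (a ^ 2 * b ^ 2) * ∫ ω in F, Q ω ∂μ : ℝ) : ℂ)‖ := by
          rw [Complex.norm_real, Real.norm_eq_abs, abs_of_nonneg hx]
      _ ≤ ∫ η, M η := by
          rw [hswap]
          exact norm_integral_le_of_norm_le hMi (ae_of_all _ hinner)
  have hpi := Real.pi_pos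
  calc ∫ ω in F, Q ω ∂μ = a ^ 2 * b ^ 2 / (16 * Real.pi ^ 2) *
        (16 * Real.pi ^ 2 / (a ^ 2 * b ^ 2) * ∫ ω in F, Q ω ∂μ) := by field_simp
    _ ≤ _ := by gcongr

/-- Coordinates in `S` and in its complement are independent. The factor over `S` is at most the
probability of the event, and factors outside `J` are at most 1 and can be dropped. -/
lemma norm_setIntegral_exp_sum_le {ι : Type*} [Fintype ι] [DecidableEq ι] {ν : Measure ℝ}
    [IsProbabilityMeasure ν] (S J : Finset ι) (hSJ : Disjoint S J) {F : Set (S → ℝ)}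
    (hF : MeasurableSet F) (s : ι → ℝ) :
    ‖∫ x in {x : ι → ℝ | S.restrict x ∈ F}, Complex.exp (((∑ k, x k * s k : ℝ) : ℂ) * Complex.I)
        ∂(Measure.pi fun _ => ν)‖ ≤
      (Measure.pi fun _ : ι => ν).real {x : ι → ℝ | S.restrict x ∈ F} *
        ∏ k ∈ J, ‖charFun ν (s k)‖ := by
  set μ : Measure (ι → ℝ) := Measure.pi fun _ => ν with hμ
  have hind : iIndepFun (fun (i : ι) (x : ι → ℝ) => x i) μ :=
    iIndepFun_pi (X := fun _ x => x) fun _ => aemeasurable_id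
  have hI := hind.indepFun_finset S Sᶜ disjoint_compl_right fun i => measurable_pi_apply i
  set F' : Set (ι → ℝ) := {x : ι → ℝ | S.restrict x ∈ F} with hF'
  have hrm : Measurable fun x : ι → ℝ => S.restrict x := Finset.measurable_restrict S
  have hFm : MeasurableSet F' := hF.preimage hrm
  set f1 : (S → ℝ) → ℂ := F.indicator fun y =>
    Complex.exp (((∑ k : S, y k * s k : ℝ) : ℂ) * Complex.I) with hf1
  set f2 : ((Sᶜ : Finset ι) → ℝ) → ℂ := fun y =>
    Complex.exp (((∑ k : (Sᶜ : Finset ι), y k * s k : ℝ) : ℂ) * Complex.I) with hf2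
  have hf1m : Measurable f1 := Measurable.indicator (by fun_prop) hF
  have hf2m : Measurable f2 := by fun_prop
  have hsplit : ∀ x : ι → ℝ, F'.indicator (fun x =>
      Complex.exp (((∑ k, x k * s k : ℝ) : ℂ) * Complex.I)) x =
      f1 (fun i : S => x i) * f2 (fun i : (Sᶜ : Finset ι) => x i) := by
    intro x
    by_cases hx : x ∈ F'
    · have hx' : (fun i : S => x i) ∈ F := hx
      rw [Set.indicator_of_mem hx, hf1, Set.indicator_of_mem hx', hf2]
      simp only
      rw [← Complex.exp_add, ← add_mul, ← Complex.ofReal_add]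
      congr 4
      rw [Finset.sum_coe_sort S (fun k => x k * s k), Finset.sum_coe_sort Sᶜ (fun k => x k * s k),
        Finset.sum_add_sum_compl]
    · have hx' : (fun i : S => x i) ∉ F := hx
      rw [Set.indicator_of_notMem hx, hf1, Set.indicator_of_notMem hx', zero_mul]
  rw [← integral_indicator hFm]
  simp_rw [hsplit]
  have hmul := (hI.comp hf1m hf2m).integral_fun_mul_eq_mul_integral
    (hf1m.comp (by fun_prop)).aestronglyMeasurable (hf2m.comp (by fun_prop)).aestronglyMeasurable
  simp only [Function.comp_apply] at hmul
  rw [hmul, norm_mul]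
  have h1 : ‖∫ x : ι → ℝ, f1 (fun i : S => x i) ∂μ‖ ≤ μ.real F' := by
    have e : ∀ x : ι → ℝ, ‖f1 (fun i : S => x i)‖ ≤ F'.indicator (fun _ => (1 : ℝ)) x := by
      intro x
      by_cases hx : x ∈ F'
      · have hx' : (fun i : S => x i) ∈ F := hx
        rw [Set.indicator_of_mem hx, hf1, Set.indicator_of_mem hx', Complex.norm_exp_ofReal_mul_I]
      · have hx' : (fun i : S => x i) ∉ F := hx
        rw [Set.indicator_of_notMem hx, hf1, Set.indicator_of_notMem hx', norm_zero]
    refine (norm_integral_le_of_norm_le ((integrable_const (1 : ℝ)).indicator hFm)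
      (ae_of_all _ e)).trans (le_of_eq ?_)
    rw [integral_indicator_const _ hFm, smul_eq_mul, mul_one]
  have h2 : ‖∫ x : ι → ℝ, f2 (fun i : (Sᶜ : Finset ι) => x i) ∂μ‖ =
      ∏ k ∈ Sᶜ, ‖charFun ν (s k)‖ := by
    have e : ∀ x : ι → ℝ, f2 (fun i : (Sᶜ : Finset ι) => x i) =
        ∏ k, (if k ∈ Sᶜ then Complex.exp ((s k * x k : ℂ) * Complex.I) else 1) := by
      intro x
      rw [Finset.prod_ite_mem, Finset.univ_inter, hf2]
      simp only
      rw [Finset.sum_coe_sort Sᶜ (fun k => x k * s k), ← Complex.exp_sum]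
      congr 1
      push_cast
      rw [Finset.sum_mul]
      exact Finset.sum_congr rfl fun k _ => by ring
    simp_rw [e]
    rw [hμ, integral_fintype_prod_eq_prod (𝕜 := ℂ)
      (f := fun k (x : ℝ) => if k ∈ Sᶜ then Complex.exp ((s k * x : ℂ) * Complex.I) else 1), norm_prod]
    rw [← Finset.univ_inter Sᶜ, ← Finset.prod_ite_mem]
    refine Finset.prod_congr rfl fun k _ => ?_
    by_cases hk : k ∈ Sᶜ
    · simp only [hk, if_true, charFun_apply_real, Finset.univ_inter]
    · simp only [hk, if_false, Finset.univ_inter]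
      simp
  have h3 : ∏ k ∈ Sᶜ, ‖charFun ν (s k)‖ ≤ ∏ k ∈ J, ‖charFun ν (s k)‖ := by
    have hsub : J ⊆ Sᶜ := by
      intro k hk
      rw [Finset.mem_compl]
      exact fun h => Finset.disjoint_left.1 hSJ h hk
    rw [← Finset.prod_sdiff hsub]
    exact mul_le_of_le_one_left (Finset.prod_nonneg fun _ _ => norm_nonneg _)
      (Finset.prod_le_one (fun _ _ => norm_nonneg _) fun _ _ => norm_charFun_le_one _)
  rw [h2]
  exact mul_le_mul h1 h3 (Finset.prod_nonneg fun _ _ => norm_nonneg _) measureReal_nonneg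

/-! ### Sub-Gaussian tails -/

lemma exp_le_add_exp_sq (x : ℝ) : Real.exp x ≤ x + Real.exp (x ^ 2) := by
  have h0 := Real.add_one_le_exp (x ^ 2)
  by_cases h : |x| ≤ 1
  · have := (abs_le.1 (Real.abs_exp_sub_one_sub_id_le h)).2
    linarith
  · rw [not_le, lt_abs] at h
    rcases h with h | h
    · have : Real.exp x ≤ Real.exp (x ^ 2) := by rw [Real.exp_le_exp]; nlinarith
      linarith
    · have : Real.exp x ≤ 1 := Real.exp_le_one_iff.2 (by linarith)
      nlinarith

/-- Exponential square integrability from Gaussian tails. -/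
lemma integrable_exp_sq_of_tail {ν : Measure ℝ} [IsProbabilityMeasure ν] {κ : ℝ} (hκ : 0 < κ)
    (h : ∀ t : ℝ, 0 ≤ t → ν.real {x : ℝ | t ≤ |x|} ≤ 2 * Real.exp (-κ * t ^ 2)) :
    Integrable (fun x : ℝ => Real.exp (κ / 2 * x ^ 2)) ν := by
  refine ⟨by fun_prop, ?_⟩
  rw [hasFiniteIntegral_iff_ofReal (ae_of_all _ fun x => (Real.exp_pos _).le)]
  -- split according to the integer part of `|x|`
  have hle : ∀ x : ℝ, ENNReal.ofReal (Real.exp (κ / 2 * x ^ 2)) ≤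
      ∑' k : ℕ, {y : ℝ | (k : ℝ) ≤ |y|}.indicator
        (fun _ => ENNReal.ofReal (Real.exp (κ / 2 * ((k : ℝ) + 1) ^ 2))) x := by
    intro x
    refine le_trans ?_ (ENNReal.le_tsum ⌊|x|⌋₊)
    rw [Set.indicator_of_mem (show x ∈ {y : ℝ | (⌊|x|⌋₊ : ℝ) ≤ |y|} from
      Nat.floor_le (abs_nonneg x))]
    refine ENNReal.ofReal_le_ofReal (Real.exp_le_exp.2 ?_)
    have := Nat.lt_floor_add_one |x|
    rw [← sq_abs x]
    gcongr
  refine lt_of_le_of_lt (lintegral_mono hle) ?_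
  have hms : ∀ k : ℕ, MeasurableSet {y : ℝ | (k : ℝ) ≤ |y|} := fun k =>
    measurableSet_le measurable_const (by fun_prop)
  rw [lintegral_tsum fun k => (measurable_const.indicator (hms k)).aemeasurable]
  have hterm : ∀ k : ℕ, ∫⁻ x, {y : ℝ | (k : ℝ) ≤ |y|}.indicator
      (fun _ => ENNReal.ofReal (Real.exp (κ / 2 * ((k : ℝ) + 1) ^ 2))) x ∂ν ≤
      ENNReal.ofReal (2 * Real.exp (2 * κ) * Real.exp (-(κ / 4)) ^ k) := by
    intro k
    rw [lintegral_indicator_const (hms k), ← ofReal_measureReal, ← ENNReal.ofReal_mul (by positivity)]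
    refine ENNReal.ofReal_le_ofReal ?_
    calc _ ≤ Real.exp (κ / 2 * ((k : ℝ) + 1) ^ 2) * (2 * Real.exp (-κ * (k : ℝ) ^ 2)) := by
          gcongr
          exact h k (by positivity)
      _ = 2 * Real.exp (κ / 2 * ((k : ℝ) + 1) ^ 2 + -κ * (k : ℝ) ^ 2) := by
          rw [Real.exp_add]; ring
      _ ≤ 2 * Real.exp (2 * κ + k * (-(κ / 4))) := by
          refine mul_le_mul_of_nonneg_left (Real.exp_le_exp.2 ?_) (by norm_num)
          nlinarith [mul_nonneg hκ.le (sq_nonneg ((k : ℝ) - 5 / 4))]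
      _ = _ := by rw [Real.exp_add, Real.exp_nat_mul]; ring
  refine lt_of_le_of_lt (ENNReal.tsum_le_tsum hterm) ?_
  have hsum : Summable fun k : ℕ => 2 * Real.exp (2 * κ) * Real.exp (-(κ / 4)) ^ k :=
    (summable_geometric_of_lt_one (Real.exp_pos _).le
      (Real.exp_lt_one_iff.2 (by linarith))).mul_left _
  rw [← ENNReal.ofReal_tsum_of_nonneg (fun k => by positivity) hsum]
  exact ENNReal.ofReal_lt_top

lemma exists_hasSubgaussianMGF {ν : Measure ℝ} [IsProbabilityMeasure ν] (h : IsSubGaussianLaw ν)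
    (hmean : ∫ x, x ∂ν = 0) : ∃ c : NNReal, 0 < c ∧ HasSubgaussianMGF (fun x : ℝ => x) c ν := by
  obtain ⟨κ, hκ, htail⟩ := h
  have hi := integrable_exp_sq_of_tail hκ htail
  set q : ℝ := κ / 2 with hq
  have hq0 : 0 < q := by positivity
  set M : ℝ := ∫ x, Real.exp (q * x ^ 2) ∂ν with hM
  have hM1 : 1 ≤ M := by
    have : ∫ x, (1 : ℝ) ∂ν ≤ M := integral_mono (integrable_const _) hi fun x => by
      simp only; rw [Real.one_le_exp_iff]; positivity
    simpa using this
  have hyoung : ∀ t x : ℝ, t * x ≤ t ^ 2 / (4 * q) + q * x ^ 2 := by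
    intro t x
    have : 0 ≤ (t - 2 * q * x) ^ 2 / (4 * q) := by positivity
    have e : (t - 2 * q * x) ^ 2 / (4 * q) = t ^ 2 / (4 * q) + q * x ^ 2 - t * x := by
      field_simp; ring
    linarith
  have hexpi : ∀ t : ℝ, Integrable (fun x : ℝ => Real.exp (t * x)) ν := by
    intro t
    refine (hi.const_mul (Real.exp (t ^ 2 / (4 * q)))).mono' (by fun_prop) (ae_of_all _ fun x => ?_)
    rw [Real.norm_eq_abs, abs_of_pos (Real.exp_pos _), ← Real.exp_add, Real.exp_le_exp]
    exact hyoung t x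
  have hidi : Integrable (fun x : ℝ => x) ν := by
    refine ((hexpi 1).add (hexpi (-1))).mono' (by fun_prop) (ae_of_all _ fun x => ?_)
    rw [Real.norm_eq_abs]
    simp only [Pi.add_apply]
    have h1 := Real.add_one_le_exp (1 * x)
    have h2 := Real.add_one_le_exp (-1 * x)
    have h3 := Real.exp_pos (1 * x)
    have h4 := Real.exp_pos (-1 * x)
    rw [abs_le]; constructor <;> linarith
  -- The first term serves small t; the other two serve t² > q.
  set L : ℝ := (M - 1) / q + M / q + 1 / (4 * q) with hL
  have hL0 : 0 < L := by
    have h1 : 0 ≤ (M - 1) / q := div_nonneg (by linarith) hq0.le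
    positivity
  refine ⟨(2 * L).toNNReal, Real.toNNReal_pos.2 (by positivity), hexpi, fun t => ?_⟩
  rw [Real.coe_toNNReal _ (by positivity)]
  have e : 2 * L * t ^ 2 / 2 = L * t ^ 2 := by ring
  rw [e, mgf]
  -- For small t the linear term of `exp_le_add_exp_sq` integrates to zero, and convexity
  -- interpolates exp(t²x²) between 1 and exp(qx²). For large t Young's inequality suffices, the
  -- constant `M` being absorbed into t².
  by_cases ht : t ^ 2 ≤ q
  · set θ : ℝ := t ^ 2 / q with hθ
    have hθ0 : 0 ≤ θ := by positivity
    have hθ1 : θ ≤ 1 := (div_le_one hq0).2 ht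
    have hpt : ∀ x : ℝ, Real.exp (t * x) ≤ t * x + ((1 - θ) + θ * Real.exp (q * x ^ 2)) := by
      intro x
      refine (exp_le_add_exp_sq (t * x)).trans ?_
      gcongr
      have hc := convexOn_exp.2 (Set.mem_univ (0 : ℝ)) (Set.mem_univ (q * x ^ 2))
        (by linarith : 0 ≤ 1 - θ) hθ0 (by ring)
      simp only [smul_eq_mul, mul_zero, zero_add, Real.exp_zero, mul_one] at hc
      have e2 : (t * x) ^ 2 = θ * (q * x ^ 2) := by rw [hθ]; field_simp
      rw [e2]; exact hc
    have hi2 : Integrable (fun x : ℝ => (1 - θ) + θ * Real.exp (q * x ^ 2)) ν :=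
      (integrable_const _).add (hi.const_mul θ)
    calc ∫ x, Real.exp (t * x) ∂ν
        ≤ ∫ x, (t * x + ((1 - θ) + θ * Real.exp (q * x ^ 2))) ∂ν :=
          integral_mono (hexpi t) ((hidi.const_mul t).add hi2) hpt
      _ = (1 - θ) + θ * M := by
          rw [integral_add (hidi.const_mul t) hi2,
            integral_add (integrable_const _) (hi.const_mul θ), integral_const_mul,
            integral_const_mul, hmean]
          simp [hM]
      _ = (M - 1) / q * t ^ 2 + 1 := by rw [hθ]; field_simp; ring
      _ ≤ Real.exp ((M - 1) / q * t ^ 2) := Real.add_one_le_exp _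
      _ ≤ Real.exp (L * t ^ 2) := by
          gcongr
          rw [hL]
          have : 0 ≤ M / q := by positivity
          have : 0 ≤ 1 / (4 * q) := by positivity
          linarith
  · rw [not_le] at ht
    calc ∫ x, Real.exp (t * x) ∂ν
        ≤ ∫ x, Real.exp (t ^ 2 / (4 * q)) * Real.exp (q * x ^ 2) ∂ν := by
          refine integral_mono (hexpi t) (hi.const_mul _) fun x => ?_
          simp only
          rw [← Real.exp_add, Real.exp_le_exp]
          exact hyoung t x
      _ = Real.exp (t ^ 2 / (4 * q)) * M := by rw [integral_const_mul]
      _ ≤ Real.exp (t ^ 2 / (4 * q)) * Real.exp M := by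
          gcongr
          linarith [Real.add_one_le_exp M]
      _ = Real.exp (t ^ 2 / (4 * q) + M) := by rw [Real.exp_add]
      _ ≤ Real.exp (L * t ^ 2) := by
          gcongr
          have h1 : M ≤ M / q * t ^ 2 := by
            rw [div_mul_eq_mul_div, le_div_iff₀ hq0]
            exact mul_le_mul_of_nonneg_left ht.le (by linarith)
          have h2 : 0 ≤ (M - 1) / q * t ^ 2 :=
            mul_nonneg (div_nonneg (by linarith) hq0.le) (sq_nonneg t)
          have h3 : t ^ 2 / (4 * q) = 1 / (4 * q) * t ^ 2 := by ring
          rw [hL, add_mul, add_mul]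
          linarith

/-- Tail bound for linear combinations with complex coefficients. -/
lemma measureReal_norm_sum_ge_le {ι : Type*} [Fintype ι] {ν : Measure ℝ}
    [IsProbabilityMeasure ν] {c : NNReal} (hc : 0 < c)
    (hν : HasSubgaussianMGF (fun x : ℝ => x) c ν) (S : Finset ι) (w : ι → ℂ) {T ε : ℝ}
    (hw : ∑ k ∈ S, ‖w k‖ ^ 2 ≤ T) (hε : 0 ≤ ε) :
    (Measure.pi fun _ : ι => ν).real {x : ι → ℝ | ε ≤ ‖∑ k ∈ S, (x k : ℂ) * w k‖} ≤
      4 * Real.exp (-(ε ^ 2 / (8 * T * c))) := by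
  set μ : Measure (ι → ℝ) := Measure.pi fun _ => ν with hμ
  have hind : iIndepFun (fun (i : ι) (x : ι → ℝ) => x i) μ :=
    iIndepFun_pi (X := fun _ x => x) fun _ => aemeasurable_id
  have hsub : ∀ i, HasSubgaussianMGF (fun x : ι → ℝ => x i) c μ := by
    intro i
    refine HasSubgaussianMGF.of_map (X := fun x : ℝ => x) (Y := fun x : ι → ℝ => x i)
      (measurable_pi_apply i).aemeasurable ?_
    rw [hμ, (measurePreserving_eval (fun _ : ι => ν) i).map_eq]
    exact hν
  have hc' : (0 : ℝ) < c := hc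
  have one : ∀ r : ι → ℝ, ∑ k ∈ S, r k ^ 2 ≤ T →
      μ.real {x : ι → ℝ | ε / 2 ≤ ∑ k ∈ S, r k * x k} ≤ Real.exp (-(ε ^ 2 / (8 * T * c))) := by
    intro r hr
    have hi : iIndepFun (fun i (x : ι → ℝ) => r i * x i) μ :=
      hind.comp (fun i y => r i * y) fun i => by fun_prop
    have h := HasSubgaussianMGF.measure_sum_ge_le_of_iIndepFun hi (s := S)
      (c := fun i => ⟨r i ^ 2, sq_nonneg _⟩ * c) (fun i _ => (hsub i).const_mul (r i))
      (ε := ε / 2) (by positivity)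
    have hsum : ((∑ i ∈ S, (⟨r i ^ 2, sq_nonneg _⟩ * c : NNReal) : NNReal) : ℝ) =
        (∑ i ∈ S, r i ^ 2) * c := by
      rw [Finset.sum_mul, NNReal.coe_sum]; rfl
    rcases (Finset.sum_nonneg fun i (_ : i ∈ S) => sq_nonneg (r i)).eq_or_lt with h0 | h0
    · have hz : ∀ i ∈ S, r i = 0 := fun i hi => by
        have := (Finset.sum_eq_zero_iff_of_nonneg fun i _ => sq_nonneg (r i)).1 h0.symm i hi
        simpa using this
      have hz' : ∀ x : ι → ℝ, ∑ k ∈ S, r k * x k = 0 := fun x =>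
        Finset.sum_eq_zero fun i hi => by rw [hz i hi, zero_mul]
      simp_rw [hz']
      by_cases he : ε = 0
      · rw [he]; simp
      · have : ¬ (ε / 2 ≤ 0) := by
          have : 0 < ε := lt_of_le_of_ne hε (Ne.symm he)
          linarith
        simp only [this, Set.ofPred_false, measureReal_empty]
        positivity
    · refine h.trans (Real.exp_le_exp.2 ?_)
      rw [hsum]
      have e : -(ε / 2) ^ 2 / (2 * ((∑ i ∈ S, r i ^ 2) * c)) =
          -(ε ^ 2 / (8 * (∑ i ∈ S, r i ^ 2) * c)) := by
        field_simp; ring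
      rw [e, neg_le_neg_iff]
      gcongr
  have habs : ∀ k, (w k).re ^ 2 ≤ ‖w k‖ ^ 2 ∧ (w k).im ^ 2 ≤ ‖w k‖ ^ 2 := by
    intro k
    rw [← Complex.normSq_eq_norm_sq, Complex.normSq_apply]
    constructor <;> nlinarith [sq_nonneg (w k).re, sq_nonneg (w k).im]
  have hre : ∑ k ∈ S, (w k).re ^ 2 ≤ T :=
    (Finset.sum_le_sum fun k _ => (habs k).1).trans hw
  have him : ∑ k ∈ S, (w k).im ^ 2 ≤ T :=
    (Finset.sum_le_sum fun k _ => (habs k).2).trans hw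
  have h1 := one (fun k => (w k).re) hre
  have h2 := one (fun k => -(w k).re) (by simpa using hre)
  have h3 := one (fun k => (w k).im) him
  have h4 := one (fun k => -(w k).im) (by simpa using him)
  have hcover : {x : ι → ℝ | ε ≤ ‖∑ k ∈ S, (x k : ℂ) * w k‖} ⊆
      ({x : ι → ℝ | ε / 2 ≤ ∑ k ∈ S, (w k).re * x k} ∪
        {x : ι → ℝ | ε / 2 ≤ ∑ k ∈ S, -(w k).re * x k}) ∪
      ({x : ι → ℝ | ε / 2 ≤ ∑ k ∈ S, (w k).im * x k} ∪
        {x : ι → ℝ | ε / 2 ≤ ∑ k ∈ S, -(w k).im * x k}) := by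
    intro x hx
    have hx : ε ≤ ‖∑ k ∈ S, (x k : ℂ) * w k‖ := hx
    have hn := Complex.norm_le_abs_re_add_abs_im (∑ k ∈ S, (x k : ℂ) * w k)
    have er : (∑ k ∈ S, (x k : ℂ) * w k).re = ∑ k ∈ S, (w k).re * x k := by
      rw [Complex.re_sum]
      exact Finset.sum_congr rfl fun k _ => by rw [Complex.re_ofReal_mul, mul_comm]
    have ei : (∑ k ∈ S, (x k : ℂ) * w k).im = ∑ k ∈ S, (w k).im * x k := by
      rw [Complex.im_sum]
      exact Finset.sum_congr rfl fun k _ => by rw [Complex.im_ofReal_mul, mul_comm]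
    rw [er, ei] at hn
    have hor : ε / 2 ≤ |∑ k ∈ S, (w k).re * x k| ∨ ε / 2 ≤ |∑ k ∈ S, (w k).im * x k| := by
      by_contra! hcon
      linarith [hcon.1, hcon.2]
    rcases hor with h | h <;> rcases le_abs.1 h with h | h
    · exact Or.inl (Or.inl h)
    · refine Or.inl (Or.inr ?_)
      change ε / 2 ≤ ∑ k ∈ S, -(w k).re * x k
      simpa [neg_mul, Finset.sum_neg_distrib] using h
    · exact Or.inr (Or.inl h)
    · refine Or.inr (Or.inr ?_)
      change ε / 2 ≤ ∑ k ∈ S, -(w k).im * x k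
      simpa [neg_mul, Finset.sum_neg_distrib] using h
  refine (measureReal_mono hcover).trans ?_
  refine (measureReal_union_le _ _).trans ?_
  refine (add_le_add (measureReal_union_le _ _) (measureReal_union_le _ _)).trans ?_
  linarith

/-! ### The Kac polynomial and its effective degree -/

lemma eval_kacPoly {n : ℕ} (x : Fin (n + 1) → ℝ) (z : ℂ) :
    (kacPoly x).eval z = ∑ k : Fin (n + 1), (x k : ℂ) * z ^ (k : ℕ) := by
  simp [kacPoly, eval_finsetSum]

lemma eval_derivative_kacPoly {n : ℕ} (x : Fin (n + 1) → ℝ) (z : ℂ) :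
    (derivative (kacPoly x)).eval z =
      ∑ k : Fin (n + 1), (x k : ℂ) * ((k : ℕ) * z ^ ((k : ℕ) - 1)) := by
  simp [kacPoly, eval_finsetSum, derivative_X_pow]

lemma eval_derivative_derivative_kacPoly {n : ℕ} (x : Fin (n + 1) → ℝ) (z : ℂ) :
    (derivative (derivative (kacPoly x))).eval z =
      ∑ k : Fin (n + 1), (x k : ℂ) *
        ((k : ℕ) * (((k : ℕ) - 1 : ℕ) * z ^ ((k : ℕ) - 1 - 1))) := by
  simp [kacPoly, eval_finsetSum, derivative_X_pow]

lemma effDegree_facts {n : ℕ} (hn : 1 ≤ n) (z : ℂ) :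
    1 ≤ effDegree n z ∧ effDegree n z ≤ n ∧ 1 - ‖z‖ ≤ 1 / effDegree n z := by
  have hn' : (1 : ℝ) ≤ n := by exact_mod_cast hn
  unfold effDegree
  split_ifs with h
  · have h1 : 0 < 1 - ‖z‖ := by linarith
    have h2 : 1 ≤ (1 - ‖z‖)⁻¹ := (one_le_inv₀ h1).2 (by linarith [norm_nonneg z])
    have hm : 1 ≤ min (n : ℝ) (1 - ‖z‖)⁻¹ := le_min hn' h2
    refine ⟨hm, min_le_left _ _, ?_⟩
    rw [le_div_iff₀ (by linarith)]
    calc _ ≤ (1 - ‖z‖) * (1 - ‖z‖)⁻¹ := by gcongr; exact min_le_right _ _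
      _ = 1 := mul_inv_cancel₀ h1.ne'
  · refine ⟨hn', le_rfl, ?_⟩
    have : 0 < 1 / (n : ℝ) := by positivity
    linarith

lemma pow_four_le_choose (k : ℕ) : (k : ℝ) ^ 4 ≤ 24 * ((k + 4).choose 4 : ℕ) := by
  have h1 := Nat.pow_sub_le_descFactorial (k + 4) 4
  rw [Nat.descFactorial_eq_factorial_mul_choose] at h1
  have h2 : k ^ 4 ≤ (k + 4 + 1 - 4) ^ 4 := Nat.pow_le_pow_left (by omega) 4
  have h3 : k ^ 4 ≤ 24 * (k + 4).choose 4 := h2.trans (by simpa [Nat.factorial] using h1)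
  exact_mod_cast h3

/-- Each term is at most k⁴ times a power of |z|. Bounding the powers by 1 gives n⁵, and comparison
with the binomial series gives (1 - |z|)⁻⁵. The constant 96 = 24 · 4 comes from 4! and from |z|⁻² ≤
4. -/
lemma sum_norm_second_coeff_sq_le {n : ℕ} (hn : 1 ≤ n) {z : ℂ} (hz0 : 1 / 2 ≤ ‖z‖)
    (hz : ‖z‖ ≤ 1) (S : Finset (Fin (n + 1))) :
    ∑ k ∈ S, ‖((k : ℕ) : ℂ) * (((k : ℕ) - 1 : ℕ) * z ^ ((k : ℕ) - 1 - 1))‖ ^ 2 ≤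
      96 * effDegree n z ^ 5 := by
  have hn' : (1 : ℝ) ≤ n := by exact_mod_cast hn
  set r := ‖z‖ with hr
  have hr0 : 0 < r := by linarith
  have hterm : ∀ k : ℕ, ‖(k : ℂ) * ((k - 1 : ℕ) * z ^ (k - 1 - 1))‖ ^ 2 ≤
      (k : ℝ) ^ 4 * (r ^ (k - 1 - 1)) ^ 2 := by
    intro k
    rw [norm_mul, norm_mul, Complex.norm_natCast, Complex.norm_natCast, norm_pow, ← hr]
    have : ((k - 1 : ℕ) : ℝ) ≤ k := by exact_mod_cast Nat.sub_le k 1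
    calc _ ≤ ((k : ℝ) * (k * r ^ (k - 1 - 1))) ^ 2 := by gcongr
      _ = _ := by ring
  have hn4 : ∑ k ∈ S, ‖((k : ℕ) : ℂ) * (((k : ℕ) - 1 : ℕ) * z ^ ((k : ℕ) - 1 - 1))‖ ^ 2 ≤
      96 * (n : ℝ) ^ 5 := by
    calc _ ≤ ∑ k ∈ S, (n : ℝ) ^ 4 := by
          refine Finset.sum_le_sum fun k _ => (hterm k).trans ?_
          have h1 : ((k : ℕ) : ℝ) ≤ n := by exact_mod_cast Nat.lt_succ_iff.1 k.2
          have h2 : (r ^ ((k : ℕ) - 1 - 1)) ^ 2 ≤ 1 :=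
            pow_le_one₀ (by positivity) (pow_le_one₀ hr0.le hz)
          calc ((k : ℕ) : ℝ) ^ 4 * (r ^ ((k : ℕ) - 1 - 1)) ^ 2 ≤ (n : ℝ) ^ 4 * 1 := by gcongr
            _ = _ := mul_one _
      _ = S.card * (n : ℝ) ^ 4 := by rw [Finset.sum_const, nsmul_eq_mul]
      _ ≤ (n + 1) * (n : ℝ) ^ 4 := by
          gcongr
          have := Finset.card_le_univ S
          rw [Fintype.card_fin] at this
          exact_mod_cast this
      _ ≤ 96 * (n : ℝ) ^ 5 := by
          have : (0 : ℝ) ≤ (n : ℝ) ^ 4 := by positivity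
          nlinarith
  have hgeo : r < 1 → ∑ k ∈ S, ‖((k : ℕ) : ℂ) * (((k : ℕ) - 1 : ℕ) * z ^ ((k : ℕ) - 1 - 1))‖ ^ 2 ≤
      96 * ((1 - r)⁻¹) ^ 5 := by
    intro hr1
    have hk : ∀ k : ℕ, ‖(k : ℂ) * ((k - 1 : ℕ) * z ^ (k - 1 - 1))‖ ^ 2 ≤
        96 * (((k + 4).choose 4 : ℕ) * r ^ k) := by
      intro k
      refine (hterm k).trans ?_
      have h1 : (r ^ (k - 1 - 1)) ^ 2 ≤ 4 * r ^ k := by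
        have h2 : r ^ (k - 1 - 1) ≤ 1 := pow_le_one₀ hr0.le hz
        have h3 : r ^ (k - 1 - 1) * r ^ 2 ≤ r ^ k := by
          rw [← pow_add]
          exact pow_le_pow_of_le_one hr0.le hz (by omega)
        have h4 : (1 / 2 : ℝ) ^ 2 ≤ r ^ 2 := by gcongr
        have h5 : 0 ≤ r ^ (k - 1 - 1) := by positivity
        nlinarith
      calc (k : ℝ) ^ 4 * (r ^ (k - 1 - 1)) ^ 2 ≤ (24 * ((k + 4).choose 4 : ℕ)) * (4 * r ^ k) := by
            gcongr
            exact pow_four_le_choose k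
        _ = _ := by ring
    have hsum := hasSum_choose_mul_geometric_of_norm_lt_one (𝕜 := ℝ) 4 (r := r)
      (by rw [Real.norm_eq_abs, abs_of_pos hr0]; exact hr1)
    calc _ ≤ ∑ k ∈ S, 96 * ((((k : ℕ) + 4).choose 4 : ℕ) * r ^ (k : ℕ)) :=
          Finset.sum_le_sum fun k _ => hk k
      _ ≤ ∑ k : Fin (n + 1), 96 * ((((k : ℕ) + 4).choose 4 : ℕ) * r ^ (k : ℕ)) :=
          Finset.sum_le_sum_of_subset_of_nonneg (Finset.subset_univ _)
            fun _ _ _ => by positivity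
      _ = ∑ k ∈ Finset.range (n + 1), 96 * (((k + 4).choose 4 : ℕ) * r ^ k) :=
          Fin.sum_univ_eq_sum_range (fun k => 96 * (((k + 4).choose 4 : ℕ) * r ^ k)) (n + 1)
      _ = 96 * ∑ k ∈ Finset.range (n + 1), (((k + 4).choose 4 : ℕ) * r ^ k) := by
          rw [Finset.mul_sum]
      _ ≤ 96 * (1 / (1 - r) ^ (4 + 1)) := by
          gcongr
          exact sum_le_hasSum _ (fun k _ => by positivity) hsum
      _ = _ := by rw [one_div, inv_pow]
  unfold effDegree
  split_ifs with h
  · rcases min_choice (n : ℝ) (1 - ‖z‖)⁻¹ with h1 | h1 <;> rw [h1]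
    · exact hn4
    · exact hgeo h
  · exact hn4

/-! ### Decay of the characteristic function -/

lemma linExp_real_mul (z u v : ℂ) (t : ℝ) (k : ℕ) :
    t * linExp z u v k = linExp z (t * u) (t * v) k := by
  unfold linExp
  rw [← Complex.re_ofReal_mul]
  congr 1
  ring

/-- The two exponentials correspond to two ranges of amplitude: below a constant the cosine is
quadratic, above it the distances to integers are used. -/
lemma eventually_prod_charFun_le {τ : ℝ} (hτ : 0 < τ) (hτ' : τ ≤ 1 / 10 ^ 4) {ν : Measure ℝ}
    [IsProbabilityMeasure ν] (hint : Integrable (fun x : ℝ => x) ν) (hmean : ∫ x, x ∂ν = 0)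
    (h0 : ν {0} = 0) :
    ∃ c : ℝ, 0 < c ∧ ∀ᶠ d : ℝ in Filter.atTop, ∀ z : ℂ, ‖z‖ ≤ 1 → 1 - ‖z‖ ≤ 1 / d →
      (∀ p : ℤ, 1 ≤ p → (p : ℝ) ≤ d ^ (7 * τ) + 1 →
        d ^ (7 * τ) / d ≤ ‖((p * z.arg / Real.pi : ℝ) : UnitAddCircle)‖) →
      ∀ m s : ℕ, d / 4 ≤ m → (m : ℝ) ≤ d → (s : ℝ) ≤ d / 2 → ∀ u v : ℂ, ‖u‖ + d * ‖v‖ ≤ d ^ 2 →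
        ∏ k ∈ Finset.range m, ‖charFun ν (linExp z u v (s + k))‖ ≤
          Real.exp (-(c * (d * (‖u‖ + d * ‖v‖) ^ 2))) + Real.exp (-(c * d ^ τ)) := by
  obtain ⟨a, b, ha, hab, hmass⟩ := exists_symmetrized_mass hint hmean h0
  set β : ℝ := (ν.prod ν).real {q : ℝ × ℝ | q.1 - q.2 ∈ Set.Icc a b} with hβ
  have hb : 0 < b := ha.trans_le hab
  have hpi := Real.pi_pos
  set c₁ : ℝ := β * (2 / Real.pi ^ 2 * a ^ 2 / (16 * 10 ^ 25)) / 2 with hc₁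
  have hc₁0 : 0 < c₁ := by positivity
  have hc₂0 : 0 < β * 8 / 2 := by positivity
  refine ⟨min c₁ (β * 8 / 2), lt_min hc₁0 hc₂0, ?_⟩
  filter_upwards [eventually_sum_lower_bounds hτ hτ' (show 0 < a / (2 * b) by positivity),
    Filter.eventually_ge_atTop 1, Filter.eventually_ge_atTop b] with d hmain hd1 hdb
  intro z hz hr hs m s hm hmd hsd u v hamp
  have hd0 : 0 < d := by linarith
  set R : ℝ := ‖u‖ + d * ‖v‖ with hR
  -- Shifting the block to start at 0 changes the amplitude only by bounded factors, because |z^s| ≥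
  -- 1/2 and s ≤ d/2.
  set u' : ℂ := (u + s * v) * z ^ s with hu'
  set v' : ℂ := v * z ^ s with hv'
  have hshift : ∀ k, linExp z u v (s + k) = linExp z u' v' k := by
    intro k
    have := linExp_add_mul z u v s 1 k
    simpa using this
  set R' : ℝ := ‖u'‖ + d * ‖v'‖ with hR'
  have hzs : 1 / 2 ≤ ‖z ^ s‖ := by
    rw [norm_pow]; exact one_half_le_pow (norm_nonneg z) hd1 hr hsd
  have hzs1 : ‖z ^ s‖ ≤ 1 := by rw [norm_pow]; exact pow_le_one₀ (norm_nonneg z) hz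
  have hR'e : R' = (‖u + s * v‖ + d * ‖v‖) * ‖z ^ s‖ := by
    rw [hR', hu', hv', norm_mul, norm_mul]; ring
  have hsv : ‖(s : ℂ) * v‖ ≤ d / 2 * ‖v‖ := by
    rw [norm_mul, Complex.norm_natCast]; gcongr
  have hR'l : R / 4 ≤ R' := by
    have h1 : ‖u‖ - ‖(s : ℂ) * v‖ ≤ ‖u + s * v‖ := norm_sub_le_norm_add _ _
    have h2 : R / 2 ≤ ‖u + s * v‖ + d * ‖v‖ := by rw [hR]; linarith [norm_nonneg u]
    have h3 : 0 ≤ R := by positivity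
    rw [hR'e]; nlinarith
  have hR'u : R' ≤ 2 * R := by
    have h1 : ‖u + s * v‖ ≤ ‖u‖ + ‖(s : ℂ) * v‖ := norm_add_le _ _
    have h2 : ‖u + s * v‖ + d * ‖v‖ ≤ 2 * R := by
      rw [hR]; linarith [norm_nonneg u, mul_nonneg hd0.le (norm_nonneg v)]
    rw [hR'e]
    exact (mul_le_of_le_one_right (by positivity) hzs1).trans h2
  have hR'0 : 0 ≤ R' := by positivity
  have hR0 : 0 ≤ R := by positivity
  have hscale : ∀ w : ℝ, 0 ≤ w → ‖((w / (2 * Real.pi) : ℝ) : ℂ) * u'‖ +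
      d * ‖((w / (2 * Real.pi) : ℝ) : ℂ) * v'‖ = w / (2 * Real.pi) * R' := by
    intro w hw
    rw [norm_mul _ u', norm_mul _ v', Complex.norm_real, Real.norm_eq_abs,
      abs_of_nonneg (by positivity), hR']
    ring
  simp_rw [hshift]
  -- In this case all phases lie in [-π, π], where 1 - cos x ≥ 2x²/π².
  by_cases hcase : b * R' ≤ Real.pi
  · refine le_trans (prod_norm_charFun_le (a := a) (b := b)
      (G := 2 / Real.pi ^ 2 * a ^ 2 / (16 * 10 ^ 25) * (d * R ^ 2)) _ _ ?_) ?_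
    · intro w hw
      have hw0 : 0 < w := ha.trans_le hw.1
      have hsq := (hmain z hz hr hs m hm u' v').1
      rw [← hR'] at hsq
      calc 2 / Real.pi ^ 2 * a ^ 2 / (16 * 10 ^ 25) * (d * R ^ 2)
          = 2 / Real.pi ^ 2 * a ^ 2 * (d * (R / 4) ^ 2 / 10 ^ 25) := by ring
        _ ≤ 2 / Real.pi ^ 2 * w ^ 2 * (d * R' ^ 2 / 10 ^ 25) := by
            gcongr
            exact hw.1
        _ ≤ 2 / Real.pi ^ 2 * w ^ 2 * ∑ k ∈ Finset.range m, linExp z u' v' k ^ 2 := by gcongr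
        _ = ∑ k ∈ Finset.range m, 2 / Real.pi ^ 2 * (linExp z u' v' k * w) ^ 2 := by
            rw [Finset.mul_sum]
            exact Finset.sum_congr rfl fun k _ => by ring
        _ ≤ _ := by
            refine Finset.sum_le_sum fun k hk => ?_
            have hkm : (k : ℝ) ≤ m := by exact_mod_cast (Finset.mem_range.1 hk).le
            have h1 : |linExp z u' v' k| ≤ R' := abs_linExp_le hz (hkm.trans hmd)
            have h2 : |linExp z u' v' k * w| ≤ Real.pi := by
              rw [abs_mul, abs_of_pos hw0]
              calc _ ≤ R' * b := mul_le_mul h1 hw.2 hw0.le hR'0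
                _ ≤ _ := by linarith
            have := Real.cos_le_one_sub_mul_cos_sq h2
            linarith
    · refine le_trans (Real.exp_le_exp.2 ?_) (le_add_of_nonneg_right (Real.exp_pos _).le)
      rw [neg_le_neg_iff]
      calc min c₁ (β * 8 / 2) * (d * R ^ 2) ≤ c₁ * (d * R ^ 2) := by
            gcongr; exact min_le_left _ _
        _ = _ := by rw [hc₁, ← hβ]; ring
  · rw [not_le] at hcase
    refine le_trans (prod_norm_charFun_le (a := a) (b := b) (G := 8 * d ^ τ) _ _ ?_) ?_
    · intro w hw
      have hw0 : 0 < w := ha.trans_le hw.1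
      set t : ℝ := w / (2 * Real.pi) with ht
      have ht0 : 0 < t := by positivity
      have hdist := (hmain z hz hr hs m hm (t * u') (t * v')).2
      rw [hscale w hw0.le] at hdist
      have hlow : a / (2 * b) ≤ w / (2 * Real.pi) * R' := by
        rw [div_mul_eq_mul_div, div_le_div_iff₀ (by positivity) (by positivity)]
        have h1 : a * Real.pi ≤ w * (b * R') := by
          exact mul_le_mul hw.1 hcase.le hpi.le hw0.le
        linarith
      have hup : w / (2 * Real.pi) * R' ≤ d ^ 3 := by
        have h1 : w / (2 * Real.pi) ≤ d / 2 := by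
          rw [div_le_div_iff₀ (by positivity) (by norm_num)]
          have := hw.2.trans hdb
          nlinarith [Real.pi_gt_three]
        calc w / (2 * Real.pi) * R' ≤ d / 2 * (2 * d ^ 2) := by
              gcongr; linarith
          _ = d ^ 3 := by ring
      have := hdist hlow hup
      calc 8 * d ^ τ ≤ 8 * ∑ k ∈ Finset.range m,
            |linExp z (t * u') (t * v') k - round (linExp z (t * u') (t * v') k)| ^ 2 := by
              gcongr
        _ = ∑ k ∈ Finset.range m,
            8 * |linExp z (t * u') (t * v') k - round (linExp z (t * u') (t * v') k)| ^ 2 := by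
              rw [Finset.mul_sum]
        _ ≤ _ := by
            refine Finset.sum_le_sum fun k _ => (eight_mul_dist_int_sq_le _).trans (le_of_eq ?_)
            rw [← linExp_real_mul, ht]
            congr 2
            field_simp
    · refine le_trans (Real.exp_le_exp.2 ?_) (le_add_of_nonneg_left (Real.exp_pos _).le)
      rw [neg_le_neg_iff]
      calc min c₁ (β * 8 / 2) * d ^ τ ≤ β * 8 / 2 * d ^ τ := by
            gcongr; exact min_le_right _ _
        _ = _ := by rw [← hβ]; ring

/-! ### Small balls for blocks of coefficients -/

lemma eventually_exp_neg_rpow_mul_pow_le {c τ : ℝ} (hc : 0 < c) (hτ : 0 < τ) :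
    ∀ᶠ d : ℝ in Filter.atTop, Real.exp (-(c * d ^ τ)) * d ^ 6 ≤ 1 := by
  have h := (tendsto_rpow_mul_exp_neg_mul_atTop_nhds_zero (6 / τ) c hc).comp
    (tendsto_rpow_atTop hτ)
  filter_upwards [h.eventually_le_const zero_lt_one, Filter.eventually_gt_atTop 0] with d h1 hd
  simp only [Function.comp_apply] at h1
  have e : (d ^ τ) ^ (6 / τ) = d ^ 6 := by
    rw [← Real.rpow_mul hd.le, mul_div_cancel₀ _ hτ.ne', ← Real.rpow_natCast]; norm_num
  rw [e] at h1
  rw [mul_comm, ← neg_mul]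
  exact h1

lemma inner_pow_add_inner_eq_linExp {z : ℂ} (hz : z ≠ 0) (η : ℂ × ℂ) (k : ℕ) :
    inner ℝ (z ^ k) η.1 + inner ℝ ((k : ℂ) * z ^ (k - 1)) η.2 =
      linExp z ((starRingEnd ℂ) η.1) ((starRingEnd ℂ) η.2 / z) k := by
  have hk : (k : ℂ) * z ^ (k - 1) = k * z ^ k / z := by
    rcases k with _ | k
    · simp
    · rw [Nat.add_sub_cancel, pow_succ]; field_simp
  rw [hk, Complex.inner, Complex.inner, linExp, ← Complex.add_re, ← Complex.conj_re]
  congr 1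
  simp only [map_add, map_mul, map_div₀, Complex.conj_conj]
  ring

/-- Produces an integrable majorant. Half of the Gaussian weight is reserved for integrability;
beyond amplitude d², where nothing is known about Φ, the other half is at most exp(-d²/64). -/
lemma weight_mul_le {d r a b c D x y Φ : ℝ} (hd : 1 ≤ d) (hr : 1 / 2 ≤ r) (hr1 : r ≤ 1)
    (ha : 1 / d ≤ a) (hb : 1 ≤ b) (hc : 0 < c) (hc' : c ≤ 1 / 64) (hx : 0 ≤ x)
    (hy : 0 ≤ y) (hD : D ≤ d ^ 2) (hΦ1 : Φ ≤ 1)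
    (hΦ : x + d * (y / r) ≤ d ^ 2 →
      Φ ≤ Real.exp (-(c * (d * (x + d * (y / r)) ^ 2))) + Real.exp (-(c * D))) :
    Real.exp (-(a ^ 2 / 4) * x ^ 2) * Real.exp (-(b ^ 2 / 4) * y ^ 2) * Φ ≤
      Real.exp (-(c * d) * x ^ 2) * Real.exp (-(c * d ^ 3) * y ^ 2) +
        Real.exp (-(c * D)) *
          (Real.exp (-(a ^ 2 / 8) * x ^ 2) * Real.exp (-(b ^ 2 / 8) * y ^ 2)) := by
  have hd0 : 0 < d := by linarith
  have hr0 : 0 < r := by linarith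
  have hyr : y ≤ y / r := by rw [le_div_iff₀ hr0]; nlinarith
  have hyr2 : y / r ≤ 2 * y := by rw [div_le_iff₀ hr0]; nlinarith
  rw [← Real.exp_add, ← Real.exp_add, ← Real.exp_add]
  set w : ℝ := a ^ 2 / 8 * x ^ 2 + b ^ 2 / 8 * y ^ 2 with hw
  have hw0 : 0 ≤ w := by positivity
  have e1 : -(a ^ 2 / 4) * x ^ 2 + -(b ^ 2 / 4) * y ^ 2 = -w + -w := by rw [hw]; ring
  have e2 : -(a ^ 2 / 8) * x ^ 2 + -(b ^ 2 / 8) * y ^ 2 = -w := by rw [hw]; ring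
  rw [e1, e2, Real.exp_add (-w) (-w)]
  have hE1 : Real.exp (-w) ≤ 1 := Real.exp_le_one_iff.2 (by linarith)
  have hE0 : 0 < Real.exp (-w) := Real.exp_pos _
  by_cases hcase : x + d * (y / r) ≤ d ^ 2
  · have h1 := hΦ hcase
    have h2 : Real.exp (-(c * (d * (x + d * (y / r)) ^ 2))) ≤
        Real.exp (-(c * d) * x ^ 2 + -(c * d ^ 3) * y ^ 2) := by
      rw [Real.exp_le_exp]
      have h3 : x ^ 2 + (d * y) ^ 2 ≤ (x + d * (y / r)) ^ 2 := by
        have h4 : x + d * y ≤ x + d * (y / r) := by gcongr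
        have h5 : (x + d * y) ^ 2 ≤ (x + d * (y / r)) ^ 2 := by gcongr
        nlinarith [mul_nonneg hx (mul_nonneg hd0.le hy)]
      have h6 := mul_le_mul_of_nonneg_left h3 (mul_nonneg hc.le hd0.le)
      nlinarith
    have hww : Real.exp (-w) * Real.exp (-w) ≤ 1 := mul_le_one₀ hE1 hE0.le hE1
    have hww' : Real.exp (-w) * Real.exp (-w) ≤ Real.exp (-w) := mul_le_of_le_one_left hE0.le hE1
    calc _ ≤ Real.exp (-w) * Real.exp (-w) *
          (Real.exp (-(c * d) * x ^ 2 + -(c * d ^ 3) * y ^ 2) + Real.exp (-(c * D))) := by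
          gcongr
          linarith
      _ = Real.exp (-w) * Real.exp (-w) * Real.exp (-(c * d) * x ^ 2 + -(c * d ^ 3) * y ^ 2) +
          Real.exp (-(c * D)) * (Real.exp (-w) * Real.exp (-w)) := by ring
      _ ≤ _ := by
          gcongr
          exact mul_le_of_le_one_left (Real.exp_pos _).le hww
  · rw [not_le] at hcase
    have hlow : d ^ 2 / 64 ≤ w := by
      have h1 : d ^ 2 ≤ x + 2 * (d * y) := by nlinarith
      have h2 : d ^ 4 ≤ 8 * (x ^ 2 + (d * y) ^ 2) := by
        have : (d ^ 2) ^ 2 ≤ (x + 2 * (d * y)) ^ 2 := by gcongr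
        nlinarith [sq_nonneg (x - 2 * (d * y)), sq_nonneg x]
      have ha2 : (1 / d) ^ 2 ≤ a ^ 2 := by gcongr
      have hb2 : 1 ≤ b ^ 2 := one_le_pow₀ hb
      have h3 : (1 / d) ^ 2 * x ^ 2 + 1 * y ^ 2 ≤ 8 * w := by
        have g1 := mul_le_mul_of_nonneg_right ha2 (sq_nonneg x)
        have g2 := mul_le_mul_of_nonneg_right hb2 (sq_nonneg y)
        rw [hw]; linarith
      have h4 : (1 / d) ^ 2 * x ^ 2 + 1 * y ^ 2 = (x ^ 2 + (d * y) ^ 2) / d ^ 2 := by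
        field_simp
      rw [h4, div_le_iff₀ (by positivity)] at h3
      have h5 : d ^ 2 * d ^ 2 ≤ 64 * w * d ^ 2 := by nlinarith
      have h6 := le_of_mul_le_mul_right h5 (by positivity)
      linarith
    have h2 : Real.exp (-w) ≤ Real.exp (-(c * D)) := by
      rw [Real.exp_le_exp, neg_le_neg_iff]
      calc c * D ≤ c * d ^ 2 := by gcongr
        _ ≤ 1 / 64 * d ^ 2 := by gcongr
        _ ≤ w := by linarith
    calc _ ≤ Real.exp (-w) * Real.exp (-w) * 1 := by gcongr
      _ ≤ Real.exp (-(c * D)) * Real.exp (-w) := by rw [mul_one]; gcongr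
      _ ≤ _ := le_add_of_nonneg_left (Real.exp_pos _).le

/-- The block [s, s + m) is disjoint from `S`, so its coefficients are independent of the event `F`
and the probability of `F` factors out. -/
lemma eventually_small_ball {τ : ℝ} (hτ : 0 < τ) (hτ' : τ ≤ 1 / 10 ^ 4) {ν : Measure ℝ}
    [IsProbabilityMeasure ν] (hint : Integrable (fun x : ℝ => x) ν) (hmean : ∫ x, x ∂ν = 0)
    (h0 : ν {0} = 0) :
    ∃ K : ℝ, 0 < K ∧ ∀ᶠ d : ℝ in Filter.atTop, ∀ z : ℂ, 1 / 2 ≤ ‖z‖ → ‖z‖ ≤ 1 →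
      1 - ‖z‖ ≤ 1 / d →
      (∀ p : ℤ, 1 ≤ p → (p : ℝ) ≤ d ^ (7 * τ) + 1 →
        d ^ (7 * τ) / d ≤ ‖((p * z.arg / Real.pi : ℝ) : UnitAddCircle)‖) →
      ∀ n m s : ℕ, d / 4 ≤ m → (m : ℝ) ≤ d → (s : ℝ) ≤ d / 2 → s + m ≤ n + 1 →
      ∀ S : Finset (Fin (n + 1)), (∀ k ∈ S, (k : ℕ) < s ∨ s + m ≤ k) →
      ∀ F : Set (S → ℝ), MeasurableSet F →
      ∀ a b : ℝ, d ^ (-(3 / 2) : ℝ) ≤ a → d ^ (-(3 / 2) : ℝ) ≤ b → ∀ α β : ℂ,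
        (Measure.pi fun _ : Fin (n + 1) => ν).real
          ({x | ‖(kacPoly x).eval z - α‖ ≤ a * d ^ (1 / 2 : ℝ) ∧
            ‖(derivative (kacPoly x)).eval z - β‖ ≤ b * d ^ (3 / 2 : ℝ)} ∩
            {x | S.restrict x ∈ F}) ≤
          K * (a * b) ^ 2 *
            (Measure.pi fun _ : Fin (n + 1) => ν).real {x | S.restrict x ∈ F} := by
  obtain ⟨c₀, hc₀, hdecay⟩ := eventually_prod_charFun_le hτ hτ' hint hmean h0
  set c : ℝ := min c₀ (1 / 64) with hc
  have hc0 : 0 < c := lt_min hc₀ (by norm_num)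
  have hpi := Real.pi_pos
  refine ⟨Real.exp 2 / (16 * Real.pi ^ 2) * (Real.pi ^ 2 / c ^ 2 + 64 * Real.pi ^ 2),
    by positivity, ?_⟩
  filter_upwards [hdecay, eventually_exp_neg_rpow_mul_pow_le hc0 hτ,
    Filter.eventually_ge_atTop 1] with d hdec hexp hd1
  intro z hz0 hz hr hs n m s hm hmd hsd hsm S hS F hF a b ha hb α β
  have hd0 : 0 < d := by linarith
  have hzne : z ≠ 0 := by rw [← norm_pos_iff]; linarith
  set μ : Measure (Fin (n + 1) → ℝ) := Measure.pi fun _ => ν with hμ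
  set F' : Set (Fin (n + 1) → ℝ) := {x | S.restrict x ∈ F} with hF'
  have hFm : MeasurableSet F' := hF.preimage (Finset.measurable_restrict S)
  have ha0 : 0 < a := lt_of_lt_of_le (Real.rpow_pos_of_pos hd0 _) ha
  have hb0 : 0 < b := lt_of_lt_of_le (Real.rpow_pos_of_pos hd0 _) hb
  set a' : ℝ := a * d ^ (1 / 2 : ℝ) with ha'
  set b' : ℝ := b * d ^ (3 / 2 : ℝ) with hb'
  have ha'l : 1 / d ≤ a' := by
    have e : 1 / d = d ^ (-(3 / 2) : ℝ) * d ^ (1 / 2 : ℝ) := by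
      rw [← Real.rpow_add hd0, one_div, ← Real.rpow_neg_one]; norm_num
    rw [e, ha']; gcongr
  have hb'l : 1 ≤ b' := by
    have e : 1 = d ^ (-(3 / 2) : ℝ) * d ^ (3 / 2 : ℝ) := by
      rw [← Real.rpow_add hd0]; norm_num
    rw [e, hb']; gcongr
  have ha'0 : 0 < a' := by positivity
  have hb'0 : 0 < b' := by positivity
  have ha'2 : a' ^ 2 = a ^ 2 * d := by
    rw [ha', mul_pow, ← Real.rpow_natCast (d ^ (1 / 2 : ℝ)), ← Real.rpow_mul hd0.le]; norm_num
  have hb'2 : b' ^ 2 = b ^ 2 * d ^ 3 := by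
    rw [hb', mul_pow, ← Real.rpow_natCast (d ^ (3 / 2 : ℝ)), ← Real.rpow_mul hd0.le]
    norm_num
  set U : (Fin (n + 1) → ℝ) → ℂ := fun x => (kacPoly x).eval z with hU
  set V : (Fin (n + 1) → ℝ) → ℂ := fun x => (derivative (kacPoly x)).eval z with hV
  have hUm : Measurable U := by
    simp only [hU, eval_kacPoly]; fun_prop
  have hVm : Measurable V := by
    simp only [hV, eval_derivative_kacPoly]; fun_prop
  set J : Finset (Fin (n + 1)) := (Finset.univ : Finset (Fin m)).map
    ⟨fun i : Fin m => ⟨s + i, by have := i.2; omega⟩, fun i j h => by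
      have := congrArg Fin.val h
      simp only at this
      exact Fin.ext (by omega)⟩ with hJ
  have hSJ : Disjoint S J := by
    rw [Finset.disjoint_left]
    intro k hk hkJ
    rw [hJ, Finset.mem_map] at hkJ
    obtain ⟨i, -, rfl⟩ := hkJ
    have h1 : s + (i : ℕ) < s ∨ s + m ≤ s + (i : ℕ) := hS _ hk
    have h2 := i.2
    omega
  set pF : ℝ := μ.real F' with hpF
  have hpF0 : 0 ≤ pF := measureReal_nonneg
  set G : ℂ × ℂ → ℝ := fun η =>
    Real.exp (-(c * d) * ‖η.1‖ ^ 2) * Real.exp (-(c * d ^ 3) * ‖η.2‖ ^ 2) +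
      Real.exp (-(c * d ^ τ)) *
        (Real.exp (-(a' ^ 2 / 8) * ‖η.1‖ ^ 2) * Real.exp (-(b' ^ 2 / 8) * ‖η.2‖ ^ 2)) with hG
  have i1 := integrable_gaussian_prod (c := c * d) (e := c * d ^ 3) (by positivity) (by positivity)
  have i2 := integrable_gaussian_prod (c := a' ^ 2 / 8) (e := b' ^ 2 / 8) (by positivity)
    (by positivity)
  have hGi : Integrable G := i1.add (i2.const_mul _)
  -- The first Gaussian integrates to (π/(cd))(π/(cd³)). The second loses up to d² from a' ≥ 1/d,
  -- which exp(-c d^τ) ≤ d⁻⁶ repays.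
  have hGint : ∫ η, G η ≤ (Real.pi ^ 2 / c ^ 2 + 64 * Real.pi ^ 2) / d ^ 4 := by
    rw [hG, integral_add i1 (i2.const_mul _), integral_const_mul,
      integral_gaussian_prod (by positivity) (by positivity),
      integral_gaussian_prod (by positivity) (by positivity), add_div]
    refine add_le_add (le_of_eq (by field_simp)) ?_
    have h1 : Real.pi / (a' ^ 2 / 8) ≤ 8 * Real.pi * d ^ 2 := by
      have h2 : (1 / d) ^ 2 ≤ a' ^ 2 := by gcongr
      rw [div_le_iff₀ (by positivity)]
      have h3 : 1 ≤ d ^ 2 * a' ^ 2 := by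
        calc (1 : ℝ) = d ^ 2 * (1 / d) ^ 2 := by field_simp
          _ ≤ _ := by gcongr
      nlinarith
    have h2 : Real.pi / (b' ^ 2 / 8) ≤ 8 * Real.pi := by
      rw [div_le_iff₀ (by positivity)]
      have : 1 ≤ b' ^ 2 := one_le_pow₀ hb'l
      nlinarith
    calc Real.exp (-(c * d ^ τ)) * (Real.pi / (a' ^ 2 / 8) * (Real.pi / (b' ^ 2 / 8)))
        ≤ Real.exp (-(c * d ^ τ)) * (8 * Real.pi * d ^ 2 * (8 * Real.pi)) := by gcongr
      _ = 64 * Real.pi ^ 2 * (Real.exp (-(c * d ^ τ)) * d ^ 6) / d ^ 4 := by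
          field_simp; ring
      _ ≤ 64 * Real.pi ^ 2 * 1 / d ^ 4 := by gcongr
      _ = _ := by rw [mul_one]
  have hmain := measureReal_small_ball_le (μ := μ) hUm hVm hFm ha'0 hb'0 α β
    (M := fun η => pF * G η) ?_ (hGi.const_mul _)
  · refine hmain.trans ?_
    rw [integral_const_mul, ha'2, hb'2]
    calc _ ≤ Real.exp 2 * (a ^ 2 * d * (b ^ 2 * d ^ 3) / (16 * Real.pi ^ 2)) *
          (pF * ((Real.pi ^ 2 / c ^ 2 + 64 * Real.pi ^ 2) / d ^ 4)) := by gcongr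
      _ = _ := by field_simp
  · intro η
    set u : ℂ := (starRingEnd ℂ) η.1 with hu
    set v : ℂ := (starRingEnd ℂ) η.2 / z with hv
    have hun : ‖u‖ = ‖η.1‖ := by rw [hu, Complex.norm_conj]
    have hvn : ‖v‖ = ‖η.2‖ / ‖z‖ := by rw [hv, norm_div, Complex.norm_conj]
    have hphase : ∀ x : Fin (n + 1) → ℝ, inner ℝ (U x) η.1 + inner ℝ (V x) η.2 =
        ∑ k, x k * linExp z u v k := by
      intro x
      simp only [hU, hV, eval_kacPoly, eval_derivative_kacPoly]
      rw [sum_inner, sum_inner, ← Finset.sum_add_distrib]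
      refine Finset.sum_congr rfl fun k _ => ?_
      rw [← inner_pow_add_inner_eq_linExp hzne, mul_add, ← Complex.real_smul, ← Complex.real_smul,
        real_inner_smul_left, real_inner_smul_left]
    simp_rw [hphase]
    have hchar := norm_setIntegral_exp_sum_le (ν := ν) S J hSJ hF fun k => linExp z u v k
    set Φ : ℝ := ∏ k ∈ J, ‖charFun ν (linExp z u v k)‖ with hΦ
    have hΦe : Φ = ∏ k ∈ Finset.range m, ‖charFun ν (linExp z u v (s + k))‖ := by
      rw [hΦ, hJ, Finset.prod_map]
      exact Fin.prod_univ_eq_prod_range (fun k => ‖charFun ν (linExp z u v (s + k))‖) m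
    have hΦ0 : 0 ≤ Φ := Finset.prod_nonneg fun _ _ => norm_nonneg _
    have hΦ1 : Φ ≤ 1 := Finset.prod_le_one (fun _ _ => norm_nonneg _)
      fun _ _ => norm_charFun_le_one _
    have hw := weight_mul_le (D := d ^ τ) (x := ‖η.1‖) (y := ‖η.2‖) (Φ := Φ) (c := c) hd1 hz0 hz
      ha'l hb'l hc0 (min_le_right _ _) (norm_nonneg _) (norm_nonneg _) (by
        rw [← Real.rpow_natCast]
        exact Real.rpow_le_rpow_of_exponent_le hd1 (by push_cast; linarith)) hΦ1 (by
        intro hle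
        rw [← hun, ← hvn] at hle ⊢
        rw [hΦe]
        refine (hdec z hz hr hs m s hm hmd hsd u v hle).trans ?_
        gcongr <;> exact min_le_left _ _)
    calc _ ≤ Real.exp (-(a' ^ 2 / 4) * ‖η.1‖ ^ 2) * Real.exp (-(b' ^ 2 / 4) * ‖η.2‖ ^ 2) *
          (pF * Φ) := by gcongr
      _ = pF * (Real.exp (-(a' ^ 2 / 4) * ‖η.1‖ ^ 2) * Real.exp (-(b' ^ 2 / 4) * ‖η.2‖ ^ 2) *
          Φ) := by ring
      _ ≤ pF * G η := by gcongr

/-! ### The joint estimate -/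

lemma measurableSet_norm_sum_ge {n : ℕ} (S : Finset (Fin (n + 1))) (w : Fin (n + 1) → ℂ) (ε : ℝ) :
    MeasurableSet {y : S → ℝ | ε ≤ ‖∑ k : S, (y k : ℂ) * w k‖} :=
  measurableSet_le measurable_const (by fun_prop)

lemma restrict_mem_norm_sum_ge {n : ℕ} (S : Finset (Fin (n + 1))) (w : Fin (n + 1) → ℂ) (ε : ℝ) :
    {x : Fin (n + 1) → ℝ | S.restrict x ∈ {y : S → ℝ | ε ≤ ‖∑ k : S, (y k : ℂ) * w k‖}} =
      {x | ε ≤ ‖∑ k ∈ S, (x k : ℂ) * w k‖} := by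
  ext x
  change ε ≤ ‖∑ k : S, (x k : ℂ) * w k‖ ↔ ε ≤ ‖∑ k ∈ S, (x k : ℂ) * w k‖
  rw [Finset.sum_coe_sort S fun k => (x k : ℂ) * w k]

/-- The joint small-ball and tail estimate for the product law. -/
lemma exists_joint_bound {τ : ℝ} (hτ : 0 < τ) (hτ' : τ ≤ 1 / 10 ^ 4) {ν : Measure ℝ}
    [IsProbabilityMeasure ν] (hsub : IsSubGaussianLaw ν) (hmean : ∫ x, x ∂ν = 0)
    (h0 : ν {0} = 0) :
    ∃ c C : ℝ, 0 < c ∧ 0 < C ∧ ∀ n : ℕ, 1 ≤ n → ∀ z : ℂ, 1 / 2 ≤ ‖z‖ → ‖z‖ ≤ 1 →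
      ∀ d : ℝ, d = effDegree n z → IsSmoothPoint n (d ^ (7 * τ)) z →
      ∀ t a b : ℝ, 0 ≤ t → d ^ (-(3 / 2) : ℝ) ≤ a → d ^ (-(3 / 2) : ℝ) ≤ b → ∀ α β : ℂ,
        (Measure.pi fun _ : Fin (n + 1) => ν).real
          {x | ‖(kacPoly x).eval z - α‖ ≤ a * d ^ (1 / 2 : ℝ) ∧
            ‖(derivative (kacPoly x)).eval z - β‖ ≤ b * d ^ (3 / 2 : ℝ) ∧
            t * d ^ (5 / 2 : ℝ) ≤ ‖(derivative (derivative (kacPoly x))).eval z‖} ≤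
          C * Real.exp (-c * t ^ 2) * (a * b) ^ 2 := by
  obtain ⟨q, hq, hmgf⟩ := exists_hasSubgaussianMGF hsub hmean
  obtain ⟨K, hK, hball⟩ := eventually_small_ball hτ hτ' hmgf.integrable hmean h0
  obtain ⟨d₀, hd₀⟩ := Filter.eventually_atTop.1 hball
  set D : ℝ := max d₀ 4 with hD
  have hD4 : 4 ≤ D := le_max_right _ _
  have hq' : (0 : ℝ) < q := hq
  -- Here 3072 = 4 · 8 · 96, from halving t, the tail bound and the coefficient sum. The term `8 *
  -- K` serves large d, and `4 * D ^ 6` serves d < D.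
  refine ⟨1 / (3072 * q), 8 * K + 4 * D ^ 6, by positivity, by positivity, ?_⟩
  intro n hn z hz0 hz d hd hsmooth t a b ht ha hb α β
  obtain ⟨hd1, hdn, hr⟩ := effDegree_facts hn z
  rw [← hd] at hd1 hdn hr
  have hd0 : 0 < d := by linarith
  have ha0 : 0 < a := lt_of_lt_of_le (Real.rpow_pos_of_pos hd0 _) ha
  have hb0 : 0 < b := lt_of_lt_of_le (Real.rpow_pos_of_pos hd0 _) hb
  set μ : Measure (Fin (n + 1) → ℝ) := Measure.pi fun _ => ν with hμ
  set w : Fin (n + 1) → ℂ := fun k =>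
    (k : ℕ) * (((k : ℕ) - 1 : ℕ) * z ^ ((k : ℕ) - 1 - 1)) with hw
  set ε : ℝ := t / 2 * d ^ (5 / 2 : ℝ) with hε
  have hε0 : 0 ≤ ε := by positivity
  have hε2 : ε ^ 2 = t ^ 2 / 4 * d ^ 5 := by
    have e : (d ^ (5 / 2 : ℝ)) ^ 2 = d ^ 5 := by
      rw [← Real.rpow_natCast (d ^ (5 / 2 : ℝ)), ← Real.rpow_mul hd0.le, ← Real.rpow_natCast d]
      norm_num
    rw [hε, mul_pow, e]; ring
  have htail : ∀ S : Finset (Fin (n + 1)), μ.real {x | ε ≤ ‖∑ k ∈ S, (x k : ℂ) * w k‖} ≤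
      4 * Real.exp (-(1 / (3072 * q)) * t ^ 2) := by
    intro S
    have h := measureReal_norm_sum_ge_le hq hmgf S w (T := 96 * d ^ 5) (by
      rw [hd]; exact sum_norm_second_coeff_sq_le hn hz0 hz S) hε0
    refine h.trans (le_of_eq ?_)
    rw [hε2]
    congr 2
    field_simp
    ring
  set E : Set (Fin (n + 1) → ℝ) := {x | ‖(kacPoly x).eval z - α‖ ≤ a * d ^ (1 / 2 : ℝ) ∧
    ‖(derivative (kacPoly x)).eval z - β‖ ≤ b * d ^ (3 / 2 : ℝ)} with hE
  set X : ℝ := Real.exp (-(1 / (3072 * q)) * t ^ 2) with hX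
  have hX0 : 0 < X := Real.exp_pos _
  by_cases hcase : D ≤ d
  · set m : ℕ := ⌊d / 2⌋₊ with hm
    have hm1 : (m : ℝ) ≤ d / 2 := Nat.floor_le (by positivity)
    have hm2 : d / 4 ≤ m := by
      have := Nat.lt_floor_add_one (d / 2)
      rw [← hm] at this
      linarith
    have hmn : 2 * m ≤ n := by
      have : (2 : ℝ) * m ≤ n := by linarith
      exact_mod_cast this
    -- If the part over `S₁` is large, the free block is [m, 2m); if the rest is large, it is [0,
    -- m).
    set S₁ : Finset (Fin (n + 1)) := Finset.univ.filter fun k => (k : ℕ) < m with hS₁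
    have hblock := hd₀ d ((le_max_left _ _).trans hcase) z hz0 hz hr
      (by have := hsmooth.2.2; rw [← hd] at this; exact this) n m
    have hone : ∀ (S : Finset (Fin (n + 1))) (s : ℕ), (s : ℝ) ≤ d / 2 → s + m ≤ n + 1 →
        (∀ k ∈ S, (k : ℕ) < s ∨ s + m ≤ k) →
        μ.real (E ∩ {x | ε ≤ ‖∑ k ∈ S, (x k : ℂ) * w k‖}) ≤ K * (a * b) ^ 2 * (4 * X) := by
      intro S s hs1 hs2 hs3
      have h := hblock s hm2 (by linarith) hs1 hs2 S hs3 _ (measurableSet_norm_sum_ge S w ε)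
        a b ha hb α β
      rw [restrict_mem_norm_sum_ge S w ε] at h
      refine h.trans ?_
      gcongr
      exact htail S
    have h1 := hone S₁ m hm1 (by omega) (by
      intro k hk
      rw [hS₁, Finset.mem_filter] at hk
      exact Or.inl hk.2)
    have h2 := hone S₁ᶜ 0 (by simp; positivity) (by omega) (by
      intro k hk
      rw [hS₁, Finset.mem_compl, Finset.mem_filter] at hk
      right
      have := not_lt.1 fun h => hk ⟨Finset.mem_univ _, h⟩
      omega)
    have hcover : {x | ‖(kacPoly x).eval z - α‖ ≤ a * d ^ (1 / 2 : ℝ) ∧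
        ‖(derivative (kacPoly x)).eval z - β‖ ≤ b * d ^ (3 / 2 : ℝ) ∧
        t * d ^ (5 / 2 : ℝ) ≤ ‖(derivative (derivative (kacPoly x))).eval z‖} ⊆
        (E ∩ {x | ε ≤ ‖∑ k ∈ S₁, (x k : ℂ) * w k‖}) ∪
        (E ∩ {x | ε ≤ ‖∑ k ∈ S₁ᶜ, (x k : ℂ) * w k‖}) := by
      rintro x ⟨hx1, hx2, hx3⟩
      rw [eval_derivative_derivative_kacPoly, ← Finset.sum_add_sum_compl S₁] at hx3
      have hn := norm_add_le (∑ k ∈ S₁, (x k : ℂ) * w k) (∑ k ∈ S₁ᶜ, (x k : ℂ) * w k)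
      have hsum : t * d ^ (5 / 2 : ℝ) = ε + ε := by rw [hε]; ring
      rw [hsum] at hx3
      have hor : ε ≤ ‖∑ k ∈ S₁, (x k : ℂ) * w k‖ ∨ ε ≤ ‖∑ k ∈ S₁ᶜ, (x k : ℂ) * w k‖ := by
        by_contra! hcon
        linarith [hcon.1, hcon.2, hx3.trans hn]
      rcases hor with h | h
      · exact Or.inl ⟨⟨hx1, hx2⟩, h⟩
      · exact Or.inr ⟨⟨hx1, hx2⟩, h⟩
    calc _ ≤ K * (a * b) ^ 2 * (4 * X) + K * (a * b) ^ 2 * (4 * X) :=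
          (measureReal_mono hcover).trans
            ((measureReal_union_le _ _).trans (add_le_add h1 h2))
      _ = 8 * K * X * (a * b) ^ 2 := by ring
      _ ≤ _ := by
          gcongr
          linarith [show 0 ≤ 4 * D ^ 6 by positivity]
  · rw [not_le] at hcase
    -- For bounded d the radii are bounded below, so the tail bound alone suffices.
    have hab : 1 ≤ D ^ 6 * (a * b) ^ 2 := by
      have h1 : d ^ (-(3 / 2) : ℝ) * d ^ (-(3 / 2) : ℝ) ≤ a * b := by gcongr
      have h2 : d ^ (-(3 / 2) : ℝ) * d ^ (-(3 / 2) : ℝ) = (d ^ 3)⁻¹ := by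
        rw [← Real.rpow_add hd0, ← Real.rpow_natCast, ← Real.rpow_neg hd0.le]; norm_num
      rw [h2] at h1
      calc (1 : ℝ) = d ^ 6 * ((d ^ 3)⁻¹) ^ 2 := by field_simp
        _ ≤ D ^ 6 * (a * b) ^ 2 := by gcongr
    have hcover : {x | ‖(kacPoly x).eval z - α‖ ≤ a * d ^ (1 / 2 : ℝ) ∧
        ‖(derivative (kacPoly x)).eval z - β‖ ≤ b * d ^ (3 / 2 : ℝ) ∧
        t * d ^ (5 / 2 : ℝ) ≤ ‖(derivative (derivative (kacPoly x))).eval z‖} ⊆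
        {x | ε ≤ ‖∑ k, (x k : ℂ) * w k‖} := by
      rintro x ⟨-, -, hx3⟩
      rw [eval_derivative_derivative_kacPoly] at hx3
      refine le_trans ?_ hx3
      rw [hε]
      gcongr
      linarith
    calc _ ≤ 4 * X := (measureReal_mono hcover).trans (htail Finset.univ)
      _ ≤ 4 * X * (D ^ 6 * (a * b) ^ 2) := le_mul_of_one_le_right (by positivity) hab
      _ = 4 * D ^ 6 * X * (a * b) ^ 2 := by ring
      _ ≤ _ := by
          gcongr
          linarith

theorem lemma3p3 :
    ∃ r₀ : ℝ, 1 / 2 < r₀ ∧ r₀ < 1 ∧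
      ∀ τ : ℝ, 0 < τ → τ ≤ 1 / 10 ^ 4 →
      ∀ ν : Measure ℝ, IsProbabilityMeasure ν → IsSubGaussianLaw ν →
        ∫ x, x ∂ν = 0 → ν {0} = 0 →
      ∃ c C : ℝ, 0 < c ∧ 0 < C ∧
        ∀ (n : ℕ), 1 ≤ n →
        ∀ (Ω : Type*) (_ : MeasurableSpace Ω) (P : Measure Ω) (_ : IsProbabilityMeasure P)
          (ξ : Fin (n + 1) → Ω → ℝ),
          (∀ k, HasLaw (ξ k) ν P) → iIndepFun ξ P →
        ∀ z : ℂ, r₀ ≤ ‖z‖ → ‖z‖ ≤ 1 →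
        ∀ d : ℝ, d = effDegree n z → IsSmoothPoint n (d ^ (7 * τ)) z →
        ∀ t a b : ℝ, 0 ≤ t →
          d ^ (-(3 / 2) + 11 * τ) ≤ a → d ^ (-(3 / 2) + 11 * τ) ≤ b →
        ∀ α β : ℂ,
          P.real {ω |
              ‖(kacPoly fun k => ξ k ω).eval z - α‖ ≤ a * d ^ (1 / 2 : ℝ) ∧
              ‖(derivative (kacPoly fun k => ξ k ω)).eval z - β‖ ≤ b * d ^ (3 / 2 : ℝ) ∧
              t * d ^ (5 / 2 : ℝ) ≤
                ‖(derivative (derivative (kacPoly fun k => ξ k ω))).eval z‖}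
            ≤ C * Real.exp (-c * t ^ 2) * (a * b) ^ 2 := by
  refine ⟨3 / 4, by norm_num, by norm_num, ?_⟩
  intro τ hτ hτ' ν hν hsub hmean h0
  obtain ⟨c, C, hc, hC, hmain⟩ := exists_joint_bound hτ hτ' hsub hmean h0
  refine ⟨c, C, hc, hC, ?_⟩
  intro n hn Ω _ P _ ξ hlaw hind z hz0 hz d hd hsmooth t a b ht ha hb α β
  have hd1 : 1 ≤ d := by rw [hd]; exact (effDegree_facts hn z).1
  -- The estimate already holds for radii down to d^{-3/2}; the extra 11τ in the exponent is slack.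
  have hle : d ^ (-(3 / 2) : ℝ) ≤ d ^ (-(3 / 2) + 11 * τ) :=
    Real.rpow_le_rpow_of_exponent_le hd1 (by linarith)
  have hmeas : ∀ k, AEMeasurable (ξ k) P := fun k => (hlaw k).aemeasurable
  have hmap : P.map (fun ω k => ξ k ω) = Measure.pi fun _ => ν := by
    rw [(iIndepFun_iff_map_fun_eq_pi_map hmeas).1 hind]
    simp_rw [fun k => (hlaw k).map_eq]
  have hE : MeasurableSet {x : Fin (n + 1) → ℝ |
      ‖(kacPoly x).eval z - α‖ ≤ a * d ^ (1 / 2 : ℝ) ∧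
      ‖(derivative (kacPoly x)).eval z - β‖ ≤ b * d ^ (3 / 2 : ℝ) ∧
      t * d ^ (5 / 2 : ℝ) ≤ ‖(derivative (derivative (kacPoly x))).eval z‖} := by
    simp only [eval_kacPoly, eval_derivative_kacPoly, eval_derivative_derivative_kacPoly]
    have h1 : MeasurableSet {x : Fin (n + 1) → ℝ |
        ‖∑ k, (x k : ℂ) * z ^ (k : ℕ) - α‖ ≤ a * d ^ (1 / 2 : ℝ)} :=
      measurableSet_le (by fun_prop) measurable_const
    have h2 : MeasurableSet {x : Fin (n + 1) → ℝ |
        ‖∑ k, (x k : ℂ) * ((k : ℕ) * z ^ ((k : ℕ) - 1)) - β‖ ≤ b * d ^ (3 / 2 : ℝ)} :=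
      measurableSet_le (by fun_prop) measurable_const
    have h3 : MeasurableSet {x : Fin (n + 1) → ℝ | t * d ^ (5 / 2 : ℝ) ≤
        ‖∑ k, (x k : ℂ) * ((k : ℕ) * (((k : ℕ) - 1 : ℕ) * z ^ ((k : ℕ) - 1 - 1)))‖} :=
      measurableSet_le measurable_const (by fun_prop)
    exact h1.inter (h2.inter h3)
  have h := hmain n hn z (by linarith) hz d hd hsmooth t a b ht (hle.trans ha) (hle.trans hb) α β
  rw [← hmap, map_measureReal_apply_of_aemeasurable (aemeasurable_pi_lambda _ hmeas) hE] at h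
  exact h
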